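/- Let $A$ be a finite totally ordered set (the alphabet, e.g. $A=\{1,\dots,m\}$) with its discrete $\sigma$-field. A \emph{general erased-word process} (GEWP) over $A$ is a stochastic process $(\mathbf W,\boldsymbol\eta)=(\mathbf W_n,\eta_n)_{n\ge 1}$ on a probability space $(\Omega,\mathcal A,\mathbb P)$ such that for every $n\ge 1$: $\mathbf W_n$ is a random word of length $n$ over $A$; $\eta_n$ is uniformly distributed on $[n]=\{1,\dots,n\}$ and independent of $\mathcal F_n:=\sigma(\mathbf W_k,\eta_{k+1}:k\ge n)$; and almost surely $\mathbf W_n$ is obtained from $\mathbf W_{n+1}$ by erasing its $\eta_{n+1}$-th letter. The GEWP is \emph{ergodic} if its law is an extreme point of the convex set of all laws of GEWPs over $A$. Write $\mathcal F\overset{a.s.}{=}\mathcal G$ if each set of either $\sigma$-field differs from some set of the other by a $\mathbb P$-null set. For a word $\mathbf w=(w_1,\dots,w_n)\in A^n$ let $\pi_{\mathbf w}$ be the stable sorting permutation of $\mathbf w$, i.e. the unique permutation of $[n]$ such that $(w_{\pi_{\mathbf w}^{-1}(1)},\dots,w_{\pi_{\mathbf w}^{-1}(n)})$ is non-decreasing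 and $\pi_{\mathbf w}^{-1}(i)<\pi_{\mathbf w}^{-1}(j)$ whenever $i<j$ and $w_{\pi_{\mathbf w}^{-1}(i)}=w_{\pi_{\mathbf w}^{-1}(j)}$. Proposition. Let $(\mathbf W,\boldsymbol\eta)$ be an ergodic GEWP over $A$, let $\boldsymbol{\mathcal F}=(\mathcal F_n)_{n\ge1}$ be the backward filtration above, and put $\eta^*_n:=\pi_{\mathbf W_n}(\eta_n)$ for $n\ge 1$. Then: (1) $\boldsymbol\eta^*=(\eta^*_n)_{n\ge1}$ is a process of local innovations for $\boldsymbol{\mathcal F}$: for every $n\ge1$, $\eta^*_n$ is independent of $\mathcal F_n$, $\mathcal F_n\overset{a.s.}{=}\sigma(\eta^*_{n+1})\vee\mathcal F_{n+1}$, and $\eta^*_n$ is uniformly distributed on a finite set; (2) $\boldsymbol\eta^*$ generates $\boldsymbol{\mathcal F}$: $\mathcal F_n\overset{a.s.}{=}\sigma(\eta^*_k:k\ge n+1)$ for every $n\ge1$; (3) in particular $\boldsymbol{\mathcal F}$ is of product type: there is a sequence $(\xi_n)_{n\ge1}$ of independent random variables with values in Borel spaces such that $\mathcal F_n\overset{a.s.}{=}\sigma(\xi_k:k\ge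 n+1)$ for every $n\ge1$. -/

import Mathlib

open MeasureTheory ProbabilityTheory
open scoped NNReal

namespace ErasedWord

universe u v

/-! Indices are shifted by one: the term with Lean index `n : ℕ` of a sequence `(x_n)_{n ≥ 1}` is
`x_{n+1}`. So `W n` is a word of length `n + 1`, `η n` takes values in the `n + 1` positions of
that word, and `F n` is the `(n + 1)`-st sigma-field. Positions are counted from `0`. -/

section AlmostSure

variable {Ω : Type u} {m₀ : MeasurableSpace Ω}

/-- Almost sure inclusion of sigma-fields. -/
def AESubfield (P : Measure Ω) (F G : MeasurableSpace Ω) : Prop :=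
  ∀ s : Set Ω, MeasurableSet[F] s → ∃ t : Set Ω, MeasurableSet[G] t ∧ P (symmDiff s t) = 0

/-- Almost sure equality of sigma-fields. -/
def AEEqField (P : Measure Ω) (F G : MeasurableSpace Ω) : Prop :=
  AESubfield P F G ∧ AESubfield P G F

end AlmostSure

section Filtrations

variable {Ω : Type u} {m₀ : MeasurableSpace Ω} {E : ℕ → Type v} [∀ n, MeasurableSpace (E n)]

/-- `ξ` is a process of local innovations for the backward filtration `F`: each `ξ_n` is a random
variable independent of `F_n` and uniformly distributed on a finite set, and
`F_n = σ(ξ_{n+1}) ∨ F_{n+1}` almost surely. -/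
structure IsLocalInnovations [∀ n, MeasurableSingletonClass (E n)]
    (F : ℕ → MeasurableSpace Ω) (ξ : ∀ n, Ω → E n) (P : Measure Ω) : Prop where
  measurable : ∀ n, Measurable (ξ n)
  indep : ∀ n, Indep (MeasurableSpace.comap (ξ n) inferInstance) (F n) P
  ae_eq : ∀ n, AEEqField P (F n) (MeasurableSpace.comap (ξ (n + 1)) inferInstance ⊔ F (n + 1))
  uniform : ∀ n, ∃ s : Set (E n), s.Finite ∧ s.Nonempty ∧ P.map (ξ n) = uniformOn s

/-- `ξ` generates the backward filtration `F`: almost surely `F_n = σ(ξ_k : k ≥ n + 1)`. -/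
def Generates (ξ : ∀ n, Ω → E n) (F : ℕ → MeasurableSpace Ω) (P : Measure Ω) : Prop :=
  ∀ n, AEEqField P (F n) (⨆ k ≥ n + 1, MeasurableSpace.comap (ξ k) inferInstance)

/-- `F` is of product type: it is generated by a sequence of independent random variables
(with values in Borel spaces). -/
def IsProductType (F : ℕ → MeasurableSpace Ω) (P : Measure Ω) : Prop :=
  ∃ (E : ℕ → Type) (_ : ∀ n, MeasurableSpace (E n)) (_ : ∀ n, StandardBorelSpace (E n))
    (ξ : ∀ n, Ω → E n),
    (∀ n, Measurable (ξ n)) ∧ iIndepFun ξ P ∧ Generates ξ F P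

end Filtrations

section GEWP

variable {Ω : Type u} {m₀ : MeasurableSpace Ω} {A : Type v} [MeasurableSpace A]

/-- The backward filtration `F_n = σ(W_k, η_{k+1} : k ≥ n)`. -/
def backwardFiltration (W : ∀ n : ℕ, Ω → Fin (n + 1) → A) (η : ∀ n : ℕ, Ω → Fin (n + 1))
    (n : ℕ) : MeasurableSpace Ω :=
  ⨆ k ≥ n, MeasurableSpace.comap (W k) inferInstance ⊔
    MeasurableSpace.comap (η (k + 1)) inferInstance

/-- `(W, η)` is a general erased-word process over the alphabet `A`. -/
structure IsGEWP (W : ∀ n : ℕ, Ω → Fin (n + 1) → A) (η : ∀ n : ℕ, Ω → Fin (n + 1))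
    (P : Measure Ω) : Prop where
  measurable_word : ∀ n, Measurable (W n)
  measurable_eraser : ∀ n, Measurable (η n)
  uniform : ∀ n, P.map (η n) = uniformOn Set.univ
  indep : ∀ n, Indep (MeasurableSpace.comap (η n) inferInstance) (backwardFiltration W η n) P
  /-- `W_n` is `W_{n+1}` with the letter at position `η_{n+1}` erased. -/
  erase : ∀ n, ∀ᵐ ω ∂P, W n ω = (η (n + 1) ω).removeNth (W (n + 1) ω)

/-- The space of sequences of pairs (word of length `n`, position in that word), `n ≥ 1`. -/
abbrev PathSpace (A : Type v) : Type v := ∀ n : ℕ, (Fin (n + 1) → A) × Fin (n + 1)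

/-- The process `(W, η)` as one random element of the path space. -/
def pathOf (W : ∀ n : ℕ, Ω → Fin (n + 1) → A) (η : ∀ n : ℕ, Ω → Fin (n + 1)) :
    Ω → PathSpace A :=
  fun ω n => (W n ω, η n ω)

variable (A) in
/-- The set of laws of general erased-word processes over `A`: the probability measures on the path
space under which the coordinate process is a general erased-word process. -/
def gewpLaws : Set (Measure (PathSpace A)) :=
  {Q | IsProbabilityMeasure Q ∧ IsGEWP (fun n x => (x n).1) (fun n x => (x n).2) Q}

/-- `(W, η)` is an ergodic GEWP: its law is an extreme point of the convex set of all laws of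
GEWPs over the same alphabet. -/
def IsErgodicGEWP (W : ∀ n : ℕ, Ω → Fin (n + 1) → A) (η : ∀ n : ℕ, Ω → Fin (n + 1))
    (P : Measure Ω) : Prop :=
  IsGEWP W η P ∧ P.map (pathOf W η) ∈ Set.extremePoints ℝ≥0 (gewpLaws A)

end GEWP

section Sorting

variable {A : Type v} [LinearOrder A]

/-- The stable sorting permutation `π_w` of the word `w`: the letter at position `i` of `w` is moved
to position `π_w(i)` of the sorted word. (`Tuple.sort w` sends a position of the sorted word to the
position in `w` that its letter comes from.) -/
def sortPerm {n : ℕ} (w : Fin n → A) : Equiv.Perm (Fin n) := (Tuple.sort w)⁻¹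

/-- `π_w` is the one permutation such that `w ∘ π_w⁻¹` is sorted and `π_w⁻¹` is increasing on each
block of positions at which the sorted word carries the same letter. -/
theorem eq_sortPerm_iff {n : ℕ} (w : Fin n → A) (σ : Equiv.Perm (Fin n)) :
    σ = sortPerm w ↔ Monotone (w ∘ ⇑σ⁻¹) ∧
      ∀ i j, i < j → w (σ⁻¹ i) = w (σ⁻¹ j) → σ⁻¹ i < σ⁻¹ j := by
  rw [sortPerm, ← inv_eq_iff_eq_inv]
  exact Tuple.eq_sort_iff

/-- The process `η*_n = π_{W_n}(η_n)`. -/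
def sortedEraser {Ω : Type u} (W : ∀ n : ℕ, Ω → Fin (n + 1) → A) (η : ∀ n : ℕ, Ω → Fin (n + 1))
    (n : ℕ) (ω : Ω) : Fin (n + 1) :=
  sortPerm (W n ω) (η n ω)

end Sorting

end ErasedWord

/-! Ergodicity makes the tail of the backward filtration trivial: conditioning on a nontrivial tail
event would split the law (`IsErgodicGEWP.measure_eq_zero_or_one`). Given F_n the permutation
π_{W_n} is fixed, so η*_n is again uniform and independent of F_n. Together η*_{n+1} and W_{n+1}
give back η_{n+1}, hence W_n, so η* is a process of local innovations. The real work is to recover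
the words from η* alone.

Sorting commutes with erasing (`sortPerm_succAbove`), so while `track` along η follows a letter
through the words, `track` along η* follows the same letter through the sorted words
(`sortPerm_track`). Order pairs (letter, relative position) lexicographically. The j-th letter of
the sorted W_n lies at or before (a, x) at time N exactly when its sorted position at time N, a
function of η*, is below the number of letters of W_N that do (`IsGEWP.lexEvent_ae_eq`). That number
over the length of W_N is a conditional probability given F_N, so by Lévy's downward theorem and the
trivial tail it tends in L¹ to a constant c (`IsErgodicGEWP.exists_tendsto_lexFrac`). Replacing the
random threshold by c times the length costs a vanishing probability, because a tracked position has
point masses O(1/N) even on events of F_N (`UniformInnovations.prob_track_le`).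

Relative positions are bounded martingales; their limits have no atoms and preserve the order of the
letters strictly (`UniformInnovations.strictMono_limPos`). Hence the lexicographic events converge,
and their limits belong to the completed future of η* (`IsErgodicGEWP.measurableSet_limLexEvent`).
Over all a and x these limits give the letters of the sorted W_n together with their limiting
positions, and listing the letters by increasing limiting position restores W_n
(`IsErgodicGEWP.measurable_word_completion`). -/

namespace ErasedWord

open Filter Topology Set

/-! ### Completed sigma-fields. -/

section Completion

variable {Ω : Type*} {m₀ : MeasurableSpace Ω} {P : Measure Ω}

/-- The completion of the sigma-field `G` by all `P`-null sets. -/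
abbrev completion (P : Measure Ω) (G : MeasurableSpace Ω) : MeasurableSpace Ω :=
  eventuallyMeasurableSpace G (ae P)

theorem aeSubfield_iff {F G : MeasurableSpace Ω} :
    AESubfield P F G ↔ F ≤ completion P G := by
  refine forall₂_congr fun s _ => ?_
  refine exists_congr fun t => and_congr_right fun _ => ?_
  exact measure_symmDiff_eq_zero_iff

theorem completion_mono {F G : MeasurableSpace Ω} (h : F ≤ G) :
    completion P F ≤ completion P G := fun _ ⟨t, ht, hst⟩ => ⟨t, h _ ht, hst⟩

theorem measurable_completion_congr {F : MeasurableSpace Ω} {β : Type*} [MeasurableSpace β]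
    {f g : Ω → β} (hf : Measurable[completion P F] f) (h : g =ᵐ[P] f) :
    Measurable[completion P F] g :=
  EventuallyMeasurable.congr hf h

theorem measurableSet_completion_congr {F : MeasurableSpace Ω} {s t : Set Ω}
    (hs : MeasurableSet[completion P F] s) (h : t =ᵐ[P] s) : MeasurableSet[completion P F] t :=
  EventuallyMeasurableSet.congr hs h

/-- A set that is approximated in measure by sets of a sigma-field belongs to its completion. -/
theorem measurableSet_completion_of_tendsto [IsFiniteMeasure P] {G : MeasurableSpace Ω}
    (D : Set Ω) (B : ℕ → Set Ω) (hB : ∀ N, MeasurableSet[G] (B N))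
    (h : Tendsto (fun N => P (symmDiff (B N) D)) atTop (𝓝 0)) :
    MeasurableSet[completion P G] D := by
  -- Along a subsequence the errors are summable, so by Borel–Cantelli the limsup of the
  -- approximating sets is a version of `D` in `G`.
  have h2 : ∀ k : ℕ, ∃ N, P (symmDiff (B N) D) < (2⁻¹ : ENNReal) ^ k := fun k =>
    ((tendsto_order.1 h).2 _ (by
      refine pos_iff_ne_zero.2 (pow_ne_zero _ (by simp)))).exists
  choose N hN using h2
  refine ⟨⋂ i, ⋃ k ≥ i, B (N k), ?_, ?_⟩
  · exact MeasurableSet.iInter fun i => MeasurableSet.iUnion fun k =>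
      MeasurableSet.iUnion fun _ => hB _
  · have hs : ∑' k, P (symmDiff (B (N k)) D) ≠ ⊤ := by
      refine ne_top_of_le_ne_top ?_ (ENNReal.tsum_le_tsum fun k => (hN k).le)
      rw [ENNReal.tsum_geometric]; simp
    have h3 := ae_eventually_notMem hs
    filter_upwards [h3] with ω hω
    obtain ⟨i, hi⟩ := eventually_atTop.1 hω
    have hi' : ∀ k ≥ i, (ω ∈ B (N k) ↔ ω ∈ D) := by
      intro k hk
      have := hi k hk
      rw [Set.mem_symmDiff] at this
      tauto
    refine propext ?_
    change ω ∈ D ↔ ω ∈ ⋂ i, ⋃ k ≥ i, B (N k)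
    simp only [Set.mem_iInter, Set.mem_iUnion, exists_prop]
    constructor
    · intro hD j
      exact ⟨max i j, le_max_right _ _, (hi' _ (le_max_left _ _)).2 hD⟩
    · intro hD
      obtain ⟨k, hk, hk'⟩ := hD i
      exact (hi' k hk).1 hk'

end Completion

/-! ### Lévy's downward theorem for a trivial tail. -/

section Tail

variable {Ω : Type*} {m₀ : MeasurableSpace Ω} {P : Measure Ω} [IsProbabilityMeasure P]

/-- Preimages of Borel sets under `g` are tail events up to null sets, so they obey the zero-one
law; countably many Borel sets separate the reals. -/
theorem exists_ae_eq_const_of_measurable_completion {F : ℕ → MeasurableSpace Ω}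
    (hF : ∀ n, F n ≤ m₀)
    (htriv : ∀ B, (∀ n, MeasurableSet[completion P (F n)] B) → P B = 0 ∨ P B = 1)
    {g : Ω → ℝ} (hg : ∀ n, AEStronglyMeasurable[F n] g P) : ∃ c, g =ᵐ[P] fun _ => c := by
  refine exists_eventuallyEq_const_of_forall_separating MeasurableSet fun U hU => ?_
  have hm : ∀ n, MeasurableSet[completion P (F n)] (g ⁻¹' U) := by
    intro n
    obtain ⟨g', hg', hgg'⟩ := hg n
    exact measurable_completion_congr
      (Measurable.eventuallyMeasurable hg'.measurable) hgg' hU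
  have hnull : NullMeasurableSet (g ⁻¹' U) P := by
    obtain ⟨t, ht, hst⟩ := hm 0
    exact ⟨t, hF 0 _ ht, hst⟩
  rcases htriv _ hm with h | h
  · exact Or.inr (measure_eq_zero_iff_ae_notMem.1 h)
  · exact Or.inl ((prob_compl_eq_zero_iff₀ hnull).2 h)

/-- **Lévy's downward theorem** for a backward filtration with trivial tail. -/
theorem tendsto_integral_abs_condExp_sub {F : ℕ → MeasurableSpace Ω} (hF : ∀ n, F n ≤ m₀)
    (hanti : Antitone F)
    (htriv : ∀ B, (∀ n, MeasurableSet[completion P (F n)] B) → P B = 0 ∨ P B = 1)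
    {f : Ω → ℝ} (hf : MemLp f 2 P) :
    Tendsto (fun n => ∫ ω, |(P[f | F n]) ω - ∫ x, f x ∂P| ∂P) atTop (𝓝 0) := by
  have : ∀ n, Fact (F n ≤ m₀) := fun n => ⟨hF n⟩
  let V : ℕ → Submodule ℝ (Lp ℝ 2 P) := fun n => lpMeas ℝ ℝ (F n) 2 P
  have hV : ∀ n, (V n).HasOrthogonalProjection := fun n => by
    change (lpMeas ℝ ℝ (F n) 2 P).HasOrthogonalProjection
    infer_instance
  have hVanti : Antitone V := by
    intro i j hij x hx
    rw [mem_lpMeas_iff_aestronglyMeasurable] at hx ⊢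
    exact hx.mono (hanti hij)
  set x : Lp ℝ 2 P := hf.toLp with hx
  have hproj : ∀ n, ((V n).starProjection x : Ω → ℝ) =ᵐ[P] P[f | F n] := fun n =>
    hf.condExpL2_ae_eq_condExp (𝕜 := ℝ) (hF n)
  -- The subspaces decrease, so their orthogonal complements increase and the projections onto these
  -- converge; subtract from `x`.
  obtain ⟨y, hy⟩ : ∃ y, Tendsto (fun n => (V n).starProjection x) atTop (𝓝 y) := by
    have h := Submodule.starProjection_tendsto_closure_iSup (fun n => (V n)ᗮ)
      (fun i j hij => Submodule.orthogonal_le (hVanti hij)) x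
    refine ⟨_, (tendsto_const_nhds (x := x).sub h).congr fun n => ?_⟩
    rw [Submodule.starProjection_orthogonal_val]
    abel
  have hym : ∀ n, AEStronglyMeasurable[F n] y P := by
    intro n
    have hc := isClosed_aestronglyMeasurable (F := ℝ) (p := 2) (μ := P) (hF n)
    refine hc.mem_of_tendsto hy (eventually_atTop.2 ⟨n, fun k hk => ?_⟩)
    have : (V k).starProjection x ∈ V n := hVanti hk (Submodule.starProjection_apply_mem _ _)
    exact mem_lpMeas_iff_aestronglyMeasurable.1 this
  obtain ⟨c, hc⟩ := exists_ae_eq_const_of_measurable_completion hF htriv hym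
  have hdist : ∀ n, ∫ ω, |(P[f | F n]) ω - c| ∂P ≤ ‖(V n).starProjection x - y‖ := by
    intro n
    have h1 : ∫ ω, |(P[f | F n]) ω - c| ∂P = ∫ ω, ‖((V n).starProjection x - y : Lp ℝ 2 P) ω‖ ∂P := by
      refine integral_congr_ae ?_
      filter_upwards [hproj n, hc, Lp.coeFn_sub ((V n).starProjection x) y] with ω h1 h2 h3
      rw [h3, Pi.sub_apply, h1, h2, Real.norm_eq_abs]
    rw [h1, Lp.norm_def, integral_norm_eq_lintegral_enorm (Lp.aestronglyMeasurable _)]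
    refine ENNReal.toReal_mono (Lp.eLpNorm_ne_top _) ?_
    rw [← eLpNorm_one_eq_lintegral_enorm]
    exact eLpNorm_le_eLpNorm_of_exponent_le one_le_two (Lp.aestronglyMeasurable _)
  have hlim : Tendsto (fun n => ∫ ω, |(P[f | F n]) ω - c| ∂P) atTop (𝓝 0) :=
    squeeze_zero (fun n => integral_nonneg fun _ => abs_nonneg _) hdist
      (tendsto_iff_norm_sub_tendsto_zero.1 hy)
  -- All the conditional expectations have the mean of `f`, which fixes the constant.
  have hcf : ∫ x, f x ∂P = c := by
    have h0 : ∀ n, |∫ x, f x ∂P - c| ≤ ∫ ω, |(P[f | F n]) ω - c| ∂P := by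
      intro n
      have : ∫ x, f x ∂P - c = ∫ ω, ((P[f | F n]) ω - c) ∂P := by
        rw [integral_sub integrable_condExp (integrable_const _), integral_condExp (hF n)]
        simp
      rw [this]
      exact abs_integral_le_integral_abs
    have := ge_of_tendsto' hlim h0
    have := abs_nonpos_iff.1 this
    linarith
  rw [hcf]
  exact hlim

end Tail

/-! ### Extremality of the law and triviality of the tail. -/

section Ergodic

variable {Ω : Type*} {m₀ : MeasurableSpace Ω} {P : Measure Ω}
variable {A : Type*} [MeasurableSpace A]
  {W : ∀ n : ℕ, Ω → Fin (n + 1) → A} {η : ∀ n : ℕ, Ω → Fin (n + 1)}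

theorem antitone_backwardFiltration : Antitone (backwardFiltration W η) := fun _ _ h =>
  iSup₂_le fun k hk => le_iSup₂_of_le k (h.trans hk) le_rfl

theorem measurable_word_backwardFiltration {n k : ℕ} (h : n ≤ k) :
    Measurable[backwardFiltration W η n] (W k) :=
  Measurable.of_comap_le (le_sup_left.trans (le_iSup₂_of_le k h le_rfl))

theorem measurable_eraser_backwardFiltration {n k : ℕ} (h : n ≤ k) :
    Measurable[backwardFiltration W η n] (η (k + 1)) :=
  Measurable.of_comap_le (le_sup_right.trans (le_iSup₂_of_le k h le_rfl))

theorem IsGEWP.backwardFiltration_le (h : IsGEWP W η P) (n : ℕ) :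
    backwardFiltration W η n ≤ m₀ :=
  iSup₂_le fun k _ => sup_le (h.measurable_word k).comap_le (h.measurable_eraser (k + 1)).comap_le

theorem backwardFiltration_comap_pathOf (n : ℕ) :
    backwardFiltration W η n = MeasurableSpace.comap (pathOf W η)
      (backwardFiltration (fun n (x : PathSpace A) => (x n).1) (fun n x => (x n).2) n) := by
  simp only [backwardFiltration, MeasurableSpace.comap_iSup, MeasurableSpace.comap_sup,
    MeasurableSpace.comap_comp]
  rfl

variable [IsProbabilityMeasure P]

theorem IsGEWP.map_pathOf [Finite A] [MeasurableSingletonClass A] (h : IsGEWP W η P) :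
    P.map (pathOf W η) ∈ gewpLaws A := by
  have hm : Measurable (pathOf W η) := measurable_pi_lambda _ fun n =>
    (h.measurable_word n).prodMk (h.measurable_eraser n)
  have hW : ∀ n, Measurable fun x : PathSpace A => (x n).1 := fun n =>
    (measurable_pi_apply n).fst
  have hη : ∀ n, Measurable fun x : PathSpace A => (x n).2 := fun n =>
    (measurable_pi_apply n).snd
  have hle : ∀ n, backwardFiltration (fun n (x : PathSpace A) => (x n).1)
      (fun n x => (x n).2) n ≤ MeasurableSpace.pi := fun n =>
    iSup₂_le fun k _ => sup_le (hW k).comap_le (hη (k + 1)).comap_le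
  refine ⟨Measure.isProbabilityMeasure_map hm.aemeasurable, hW, hη, fun n => ?_, fun n => ?_,
    fun n => ?_⟩
  · rw [Measure.map_map (hη n) hm]
    exact h.uniform n
  · rw [Indep_iff]
    rintro _ t ⟨s, hs, rfl⟩ ht
    rw [Measure.map_apply hm ((hη n hs).inter (hle n t ht)), Measure.map_apply hm (hη n hs),
      Measure.map_apply hm (hle n t ht)]
    refine (Indep_iff _ _ _).1 (h.indep n) _ _ ⟨s, hs, rfl⟩ ?_
    rw [backwardFiltration_comap_pathOf]
    exact ⟨t, ht, rfl⟩
  · have := h.erase n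
    rw [ae_map_iff hm.aemeasurable]
    · exact this
    · exact ((hW n).prodMk ((hη (n + 1)).prodMk (hW (n + 1)))) (MeasurableSet.of_discrete
        (s := {p : (Fin (n + 1) → A) × Fin (n + 1 + 1) × (Fin (n + 1 + 1) → A) |
          p.1 = p.2.1.removeNth p.2.2}))

/-- Conditioning a GEWP on a tail event gives a GEWP. -/
theorem IsGEWP.cond (h : IsGEWP W η P) {B : Set Ω} (hB0 : P B ≠ 0)
    (hB : ∀ n, MeasurableSet[completion P (backwardFiltration W η n)] B) :
    IsGEWP W η (ProbabilityTheory.cond P B) := by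
  -- For each `n` the tail event has a version `C` in F_n, and `η n` is independent of `C ∩ t`; so
  -- conditioning changes neither the law of `η n` nor its independence of F_n.
  have key : ∀ n (s : Set (Fin (n + 1))) (t : Set Ω),
      MeasurableSet[backwardFiltration W η n] t →
      ProbabilityTheory.cond P B (η n ⁻¹' s ∩ t) = P (η n ⁻¹' s) * ProbabilityTheory.cond P B t := by
    intro n s t ht
    obtain ⟨C, hC, hBC⟩ := hB n
    have hcond : ProbabilityTheory.cond P B = ProbabilityTheory.cond P C := by
      simp only [ProbabilityTheory.cond, Measure.restrict_congr_set hBC, measure_congr hBC]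
    have hC' := h.backwardFiltration_le n _ hC
    rw [hcond, cond_apply hC', cond_apply hC', Set.inter_left_comm,
      (Indep_iff _ _ _).1 (h.indep n) _ _ ⟨s, MeasurableSet.of_discrete, rfl⟩ (hC.inter ht)]
    ring
  have := cond_isProbabilityMeasure hB0
  have key' : ∀ n (s : Set (Fin (n + 1))),
      ProbabilityTheory.cond P B (η n ⁻¹' s) = P (η n ⁻¹' s) := by
    intro n s
    have := key n s Set.univ MeasurableSet.univ
    rwa [Set.inter_univ, measure_univ, mul_one] at this
  refine ⟨h.measurable_word, h.measurable_eraser, fun n => ?_, fun n => ?_, fun n => ?_⟩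
  · rw [← h.uniform n]
    ext s hs
    rw [Measure.map_apply (h.measurable_eraser n) hs, Measure.map_apply (h.measurable_eraser n) hs,
      key']
  · rw [Indep_iff]
    rintro _ t ⟨s, hs, rfl⟩ ht
    rw [key n s t ht, key']
  · exact cond_absolutelyContinuous.ae_le (h.erase n)

/-- The tail sigma-field of an ergodic GEWP is trivial. -/
theorem IsErgodicGEWP.measure_eq_zero_or_one [Finite A] [MeasurableSingletonClass A]
    (h : IsErgodicGEWP W η P) (B : Set Ω)
    (hB : ∀ n, MeasurableSet[completion P (backwardFiltration W η n)] B) : P B = 0 ∨ P B = 1 := by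
  obtain ⟨h, hext⟩ := h
  -- A version of `B` in F_0 is the preimage of a set of paths, so its probability can be read off
  -- the law of the process.
  wlog hBm : MeasurableSet[backwardFiltration W η 0] B generalizing B
  · obtain ⟨C, hC, hBC⟩ := hB 0
    rw [measure_congr hBC]
    exact this C (fun n => measurableSet_completion_congr (hB n) hBC.symm) hC
  by_contra hcon
  push Not at hcon
  obtain ⟨h0, h1⟩ := hcon
  have hBm₀ := h.backwardFiltration_le 0 _ hBm
  have h0' : P Bᶜ ≠ 0 := fun h' => h1 ((prob_compl_eq_zero_iff hBm₀).1 h')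
  have hBc : ∀ n, MeasurableSet[completion P (backwardFiltration W η n)] Bᶜ := fun n =>
    (hB n).compl
  have hm : Measurable (pathOf W η) := measurable_pi_lambda _ fun n =>
    (h.measurable_word n).prodMk (h.measurable_eraser n)
  have := cond_isProbabilityMeasure h0
  have := cond_isProbabilityMeasure h0'
  have e1 := (h.cond h0 hB).map_pathOf
  have e2 := (h.cond h0' hBc).map_pathOf
  have hseg : P.map (pathOf W η) ∈ openSegment ℝ≥0
      ((ProbabilityTheory.cond P B).map (pathOf W η))
      ((ProbabilityTheory.cond P Bᶜ).map (pathOf W η)) := by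
    refine ⟨(P B).toNNReal, (P Bᶜ).toNNReal, ENNReal.toNNReal_pos h0 (measure_ne_top _ _),
      ENNReal.toNNReal_pos h0' (measure_ne_top _ _), ?_, ?_⟩
    · rw [← ENNReal.toNNReal_add (measure_ne_top _ _) (measure_ne_top _ _),
        prob_add_prob_compl hBm₀]
      rfl
    · ext s hs
      have hc : ∀ C, P C ≠ 0 → MeasurableSet C → ((P C).toNNReal •
          (ProbabilityTheory.cond P C).map (pathOf W η)) s = P (C ∩ pathOf W η ⁻¹' s) := by
        intro C hC hCm
        rw [Measure.smul_apply, Measure.map_apply hm hs, cond_apply hCm, ENNReal.smul_def,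
          ENNReal.coe_toNNReal (measure_ne_top _ _), smul_eq_mul, ← mul_assoc,
          ENNReal.mul_inv_cancel hC (measure_ne_top _ _), one_mul]
      rw [Measure.add_apply, hc B h0 hBm₀, hc _ h0' hBm₀.compl, Measure.map_apply hm hs,
        Set.inter_comm, Set.inter_comm Bᶜ, ← Set.sdiff_eq, measure_inter_add_sdiff _ hBm₀]
  -- Extremality identifies the law given `B` with the unconditioned one; but the former gives `B`
  -- probability one.
  have heq := hext.2 e1 e2 hseg
  rw [backwardFiltration_comap_pathOf] at hBm
  obtain ⟨S, hS, rfl⟩ := hBm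
  have hS' : MeasurableSet S := by
    refine (?_ : backwardFiltration (fun n (x : PathSpace A) => (x n).1)
      (fun n x => (x n).2) 0 ≤ MeasurableSpace.pi) _ hS
    exact iSup₂_le fun k _ => sup_le (measurable_pi_apply k).fst.comap_le
      (measurable_pi_apply (k + 1)).snd.comap_le
  have := congrArg (fun μ => μ S) heq
  simp only [Measure.map_apply hm hS'] at this
  rw [cond_apply_self h0 (measure_ne_top _ _)] at this
  exact h1 this.symm

end Ergodic

/-! ### Stable sorting, erasing, and tracking of letters. -/

section Combinatorics

variable {A : Type*} [LinearOrder A]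

theorem lex_of_sortPerm_lt {n : ℕ} (w : Fin n → A) {k l : Fin n}
    (h : sortPerm w k < sortPerm w l) : w k < w l ∨ w k = w l ∧ k < l := by
  obtain ⟨h1, h2⟩ := (eq_sortPerm_iff w _).1 rfl
  have h3 := h1 h.le
  have h4 := h2 _ _ h
  simp only [Function.comp_apply, Equiv.Perm.inv_def, Equiv.symm_apply_apply] at h3 h4
  exact h3.lt_or_eq.imp_right fun h => ⟨h, h4 h⟩

theorem sortPerm_lt_iff {n : ℕ} (w : Fin n → A) {k l : Fin n} :
    sortPerm w k < sortPerm w l ↔ w k < w l ∨ w k = w l ∧ k < l := by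
  refine ⟨lex_of_sortPerm_lt w, fun h => ?_⟩
  rcases lt_trichotomy (sortPerm w k) (sortPerm w l) with h' | h' | h'
  · exact h'
  · rw [(sortPerm w).injective h'] at h
    simp at h
  · rcases lex_of_sortPerm_lt w h' with h1 | ⟨h1, h2⟩ <;> rcases h with h | ⟨h, h3⟩
    · exact absurd h h1.asymm
    · exact absurd h h1.ne'
    · exact absurd h1 h.ne'
    · exact absurd h2 h3.asymm

/-- Sorting commutes with erasing a letter. -/
theorem sortPerm_succAbove {n : ℕ} (w : Fin (n + 1) → A) (e : Fin (n + 1)) (i : Fin n) :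
    sortPerm w (e.succAbove i) =
      (sortPerm w e).succAbove (sortPerm (e.removeNth w) i) := by
  set τ := sortPerm (e.removeNth w) with hτ
  -- Both this map and `succAbove` at the sorted erased position are strictly increasing and miss
  -- only that position; a strictly increasing map is determined by its range.
  have hmono : StrictMono fun s => sortPerm w (e.succAbove (τ.symm s)) := by
    intro s t hst
    rw [sortPerm_lt_iff]
    have : τ (τ.symm s) < τ (τ.symm t) := by simpa using hst
    rw [hτ, sortPerm_lt_iff, ← hτ] at this
    simpa [Fin.removeNth, Fin.succAbove_lt_succAbove_iff] using this
  have := (hmono.range_inj (Fin.strictMono_succAbove (sortPerm w e))).1 (by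
    rw [Fin.range_succAbove]
    have h1 : (fun s => sortPerm w (e.succAbove (τ.symm s))) =
      sortPerm w ∘ e.succAbove ∘ τ.symm := rfl
    rw [h1, Set.range_comp, Set.range_comp, τ.symm.surjective.range_eq, Set.image_univ,
      Fin.range_succAbove, Set.image_compl_eq (sortPerm w).bijective, Set.image_singleton])
  have := congrFun this (τ i)
  simpa using this

/-- Sorting a word sends the positions of an initial segment of its lexicographically ordered
letters to an initial segment of positions. -/
theorem sortPerm_lt_card_iff {n : ℕ} (w : Fin n → A) (S : Finset (Fin n))
    (hS : ∀ k l, l ∈ S → (w k < w l ∨ w k = w l ∧ k < l) → k ∈ S) (k : Fin n) :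
    (sortPerm w k : ℕ) < S.card ↔ k ∈ S := by
  have hcard : (S.map (sortPerm w).toEmbedding).card = S.card := Finset.card_map _
  constructor
  · intro h
    by_contra hk
    have : S.map (sortPerm w).toEmbedding ⊆ Finset.Iio (sortPerm w k) := by
      intro s hs
      obtain ⟨l, hl, rfl⟩ := Finset.mem_map.1 hs
      rw [Finset.mem_Iio]
      by_contra hlt
      rcases (not_lt.1 hlt).lt_or_eq with h' | h'
      · exact hk (hS k l hl ((sortPerm_lt_iff w).1 h'))
      · exact hk ((sortPerm w).injective h' ▸ hl)
    have := Finset.card_le_card this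
    rw [Fin.card_Iio] at this
    omega
  · intro h
    have : Finset.Iic (sortPerm w k) ⊆ S.map (sortPerm w).toEmbedding := by
      intro s hs
      rw [Finset.mem_Iic] at hs
      refine Finset.mem_map.2 ⟨(sortPerm w).symm s, ?_, by simp⟩
      rcases hs.lt_or_eq with h' | h'
      · refine hS _ k h ((sortPerm_lt_iff w).1 (by simpa using h'))
      · rwa [h', Equiv.symm_apply_apply]
    have := Finset.card_le_card this
    rw [Fin.card_Iic] at this
    omega

/-- The position at time `n + m` of the letter that has position `j` at time `n`, when the letter
erased at each time `k` is at position `e k`. -/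
def track (e : ∀ k : ℕ, Fin (k + 1)) (n : ℕ) : ∀ m : ℕ, Fin (n + 1) → Fin (n + m + 1)
  | 0 => id
  | m + 1 => fun j => (e (n + m + 1)).succAbove (track e n m j)

theorem track_succ (e : ∀ k : ℕ, Fin (k + 1)) (n m : ℕ) (j : Fin (n + 1)) :
    track e n (m + 1) j = (e (n + m + 1)).succAbove (track e n m j) := rfl

theorem strictMono_track (e : ∀ k : ℕ, Fin (k + 1)) (n m : ℕ) : StrictMono (track e n m) := by
  induction m with
  | zero => exact strictMono_id
  | succ m ih => exact (Fin.strictMono_succAbove _).comp ih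

theorem word_track {A : Type*} {w : ∀ n : ℕ, Fin (n + 1) → A} {e : ∀ k : ℕ, Fin (k + 1)}
    (h : ∀ n, w n = (e (n + 1)).removeNth (w (n + 1))) (n m : ℕ) (i : Fin (n + 1)) :
    w (n + m) (track e n m i) = w n i := by
  induction m with
  | zero => rfl
  | succ m ih => rw [← ih, h (n + m)]; rfl

/-- Iterates `sortPerm_succAbove`. The sorted position at time `n + m` thus depends only on the
initial sorted position and the sorted erasers, not on the words in between. -/
theorem sortPerm_track {w : ∀ n : ℕ, Fin (n + 1) → A} {e : ∀ k : ℕ, Fin (k + 1)}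
    (h : ∀ n, w n = (e (n + 1)).removeNth (w (n + 1))) (n m : ℕ) (i : Fin (n + 1)) :
    sortPerm (w (n + m)) (track e n m i) =
      track (fun k => sortPerm (w k) (e k)) n m (sortPerm (w n) i) := by
  induction m with
  | zero => rfl
  | succ m ih =>
    rw [track_succ, track_succ, ← ih, h (n + m)]
    exact sortPerm_succAbove _ _ _

end Combinatorics

/-! ### Uniform innovations and the law of tracked positions. -/

section Innovations

variable {Ω : Type*} {m₀ : MeasurableSpace Ω} {P : Measure Ω}

theorem measureReal_eq_sum_fiber [IsFiniteMeasure P] {β : Type*} [Fintype β] [MeasurableSpace β]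
    [MeasurableSingletonClass β] {f : Ω → β} (hf : Measurable f) (B : Set Ω) :
    P.real B = ∑ b, P.real (f ⁻¹' {b} ∩ B) := by
  have h := sum_measureReal_preimage_singleton (μ := P.restrict B) (f := f) Finset.univ
    fun b _ => hf (measurableSet_singleton b)
  simp only [Finset.coe_univ, Set.preimage_univ, measureReal_restrict_apply_univ] at h
  rw [← h]
  exact Finset.sum_congr rfl fun b _ =>
    measureReal_restrict_apply (hf (measurableSet_singleton b))

/-- `ξ` is adapted to the backward filtration `F`, and each `ξ_n` is independent of `F_n` and
uniformly distributed. -/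
structure UniformInnovations (F : ℕ → MeasurableSpace Ω) (ξ : ∀ n : ℕ, Ω → Fin (n + 1))
    (P : Measure Ω) : Prop where
  le : ∀ n, F n ≤ m₀
  antitone : Antitone F
  measurable : ∀ n, Measurable (ξ n)
  adapted : ∀ n, Measurable[F n] (ξ (n + 1))
  prob : ∀ n (e : Fin (n + 1)) (C : Set Ω), MeasurableSet[F n] C →
    P.real (ξ n ⁻¹' {e} ∩ C) = P.real C / (n + 1)

variable {F : ℕ → MeasurableSpace Ω} {ξ : ∀ n : ℕ, Ω → Fin (n + 1)}

theorem UniformInnovations.measurable_track (h : UniformInnovations F ξ P) (n m : ℕ)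
    (j : Fin (n + 1)) : Measurable fun ω => track (fun k => ξ k ω) n m j := by
  induction m with
  | zero => exact measurable_const
  | succ m ih =>
    exact (measurable_of_finite fun p : Fin (n + m + 1 + 1) × Fin (n + m + 1) =>
      p.1.succAbove p.2).comp ((h.measurable _).prodMk ih)

variable [IsProbabilityMeasure P]

theorem UniformInnovations.prob_singleton (h : UniformInnovations F ξ P) (n : ℕ)
    (e : Fin (n + 1)) : P.real (ξ n ⁻¹' {e}) = 1 / (n + 1) := by
  simpa using h.prob n e Set.univ MeasurableSet.univ

theorem UniformInnovations.indep (h : UniformInnovations F ξ P) (n : ℕ) :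
    Indep (MeasurableSpace.comap (ξ n) inferInstance) (F n) P := by
  rw [Indep_iff]
  rintro _ C ⟨s, -, rfl⟩ hC
  have hsum : ∀ D : Set Ω, P.real (ξ n ⁻¹' s ∩ D) =
      ∑ e ∈ s.toFinite.toFinset, P.real (ξ n ⁻¹' {e} ∩ D) := by
    intro D
    have h1 := sum_measureReal_preimage_singleton (μ := P.restrict D) (f := ξ n)
      s.toFinite.toFinset fun b _ => h.measurable n (measurableSet_singleton b)
    rw [Set.Finite.coe_toFinset, measureReal_restrict_apply (h.measurable n .of_discrete)] at h1
    rw [← h1]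
    exact Finset.sum_congr rfl fun b _ =>
      measureReal_restrict_apply (h.measurable n (measurableSet_singleton b))
  have h2 : P.real (ξ n ⁻¹' s ∩ C) = P.real (ξ n ⁻¹' s) * P.real C := by
    rw [hsum C, ← Set.inter_univ (ξ n ⁻¹' s), hsum, Finset.sum_mul]
    refine Finset.sum_congr rfl fun e _ => ?_
    rw [h.prob n e C hC, Set.inter_univ, h.prob_singleton]
    ring
  rw [← ENNReal.toReal_eq_toReal_iff' (measure_ne_top _ _)
    (ENNReal.mul_ne_top (measure_ne_top _ _) (measure_ne_top _ _)), ENNReal.toReal_mul]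
  exact h2

theorem UniformInnovations.map_eq (h : UniformInnovations F ξ P) (n : ℕ) :
    P.map (ξ n) = uniformOn Set.univ := by
  refine Measure.ext_of_singleton fun e => ?_
  rw [Measure.map_apply (h.measurable n) (measurableSet_singleton e), uniformOn_univ,
    ← ofReal_measureReal, h.prob_singleton]
  simp only [Measure.count_singleton, Fintype.card_fin]
  rw [ENNReal.ofReal_div_of_pos (by positivity), ENNReal.ofReal_one]
  congr 1
  rw [← Nat.cast_succ, ENNReal.ofReal_natCast]

/-- Peel off the smallest index `a`: all the others are measurable with respect to `F a`, of which
`ξ a` is independent. -/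
theorem UniformInnovations.iIndepFun (h : UniformInnovations F ξ P) : iIndepFun ξ P := by
  rw [iIndepFun_iff_measure_inter_preimage_eq_mul]
  intro S sets _
  induction S using Finset.induction_on_min with
  | empty => simp
  | insert a s ha ih =>
    have hs : a ∉ s := fun h' => lt_irrefl _ (ha a h')
    rw [Finset.prod_insert hs, ← ih fun _ _ => .of_discrete, Finset.set_biInter_insert]
    refine (Indep_iff _ _ _).1 (h.indep a) _ _ ⟨_, .of_discrete, rfl⟩ ?_
    refine Finset.measurableSet_biInter _ fun i hi => ?_
    obtain ⟨k, rfl⟩ : ∃ k, i = k + 1 := ⟨i - 1, by have := ha i hi; omega⟩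
    exact h.antitone (Nat.le_of_lt_succ (ha _ hi)) _ (h.adapted k .of_discrete)

/-- The positions of a uniformly chosen tuple of distinct letters remain uniformly distributed, and
independent of the remaining filtration. -/
theorem UniformInnovations.sum_track (h : UniformInnovations F ξ P) {ι : Type*} [Fintype ι]
    [DecidableEq ι] (n m : ℕ) (f : ι → Fin (n + m + 1)) (hf : Function.Injective f) (C : Set Ω)
    (hC : MeasurableSet[F (n + m)] C) :
    (∑ g : ι → Fin (n + 1), P.real ({ω | ∀ i, track (fun k => ξ k ω) n m (g i) = f i} ∩ C)) *
      (n + m + 1).descFactorial (Fintype.card ι) =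
        (n + 1).descFactorial (Fintype.card ι) * P.real C := by
  induction m generalizing C with
  | zero =>
    rw [Fintype.sum_eq_single f]
    · have : {ω : Ω | ∀ i, track (fun k => ξ k ω) n 0 (f i) = f i} = Set.univ :=
        Set.eq_univ_of_forall fun _ _ => rfl
      rw [this, Set.univ_inter, mul_comm]
    · intro g hg
      have : {ω : Ω | ∀ i, track (fun k => ξ k ω) n 0 (g i) = f i} = ∅ := by
        refine Set.eq_empty_of_forall_notMem fun ω hω => hg (funext hω)
      simp [this]
  | succ m ih =>
    have hcomm : (∑ g : ι → Fin (n + 1),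
        P.real ({ω | ∀ i, track (fun k => ξ k ω) n (m + 1) (g i) = f i} ∩ C)) =
        ∑ e : Fin (n + m + 1 + 1), ∑ g : ι → Fin (n + 1), P.real ({ω | ∀ i, e.succAbove
          (track (fun k => ξ k ω) n m (g i)) = f i} ∩ (ξ (n + m + 1) ⁻¹' {e} ∩ C)) := by
      rw [Finset.sum_comm]
      refine Finset.sum_congr rfl fun g _ => ?_
      rw [measureReal_eq_sum_fiber (h.measurable (n + m + 1))]
      refine Finset.sum_congr rfl fun e _ => ?_
      congr 1
      ext ω
      simp only [track_succ, Set.mem_inter_iff, Set.mem_preimage, Set.mem_singleton_iff,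
        Set.mem_ofPred_eq]
      constructor
      · rintro ⟨rfl, h1, h2⟩; exact ⟨h1, rfl, h2⟩
      · rintro ⟨h1, rfl, h2⟩; exact ⟨rfl, h1, h2⟩
    -- The last innovation `e` cannot be one of the targets, since `succAbove` avoids it. Otherwise
    -- the targets pull back along `e`, and the induction hypothesis applies on `{ξ = e} ∩ C`, which
    -- lies in the larger field `F (n + m)`.
    have hterm : ∀ e : Fin (n + m + 1 + 1), (∑ g : ι → Fin (n + 1), P.real ({ω | ∀ i, e.succAbove
          (track (fun k => ξ k ω) n m (g i)) = f i} ∩ (ξ (n + m + 1) ⁻¹' {e} ∩ C))) *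
          (n + m + 1).descFactorial (Fintype.card ι) =
        if e ∈ Finset.univ.image f then 0 else
          (n + 1).descFactorial (Fintype.card ι) * (P.real C / (n + m + 1 + 1)) := by
      intro e
      split_ifs with he
      · obtain ⟨i, -, hi⟩ := Finset.mem_image.1 he
        rw [Finset.sum_eq_zero, zero_mul]
        intro g _
        have : {ω | ∀ i, e.succAbove (track (fun k => ξ k ω) n m (g i)) = f i} = ∅ :=
          Set.eq_empty_of_forall_notMem fun ω hω => Fin.succAbove_ne e _ ((hω i).trans hi)
        simp [this]
      · have he' : ∀ i, ∃ s, e.succAbove s = f i := fun i =>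
          Fin.exists_succAbove_eq fun h' => he (Finset.mem_image.2 ⟨i, Finset.mem_univ _, h'⟩)
        choose f' hf' using he'
        have hinj : Function.Injective f' := fun i j hij => hf (by rw [← hf', ← hf', hij])
        have := ih f' hinj (ξ (n + m + 1) ⁻¹' {e} ∩ C)
          ((h.adapted (n + m) .of_discrete).inter (h.antitone (Nat.le_succ _) _ hC))
        rw [h.prob (n + m + 1) e C hC] at this
        push_cast at this
        simp only [← hf', Fin.succAbove_right_inj]
        exact this
    have hcard : (Finset.univ.filter fun e : Fin (n + m + 1 + 1) => e ∉ Finset.univ.image f).card =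
        n + m + 1 + 1 - Fintype.card ι := by
      rw [Finset.filter_not, Finset.filter_mem_eq_inter, Finset.univ_inter,
        ← Finset.compl_eq_univ_sdiff, Finset.card_compl, Finset.card_image_of_injective _ hf,
        Fintype.card_fin, Finset.card_univ]
    have hdesc := Nat.succ_descFactorial (n + m + 1) (Fintype.card ι)
    set S := ∑ g : ι → Fin (n + 1),
      P.real ({ω | ∀ i, track (fun k => ξ k ω) n (m + 1) (g i) = f i} ∩ C) with hS
    have h1 : S * (n + m + 1).descFactorial (Fintype.card ι) =
        ((n + m + 1 + 1 - Fintype.card ι : ℕ) : ℝ) *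
          ((n + 1).descFactorial (Fintype.card ι) * (P.real C / (n + m + 1 + 1))) := by
      rw [hcomm, Finset.sum_mul, Finset.sum_congr rfl fun e _ => hterm e]
      rw [Finset.sum_ite, Finset.sum_const_zero, zero_add, Finset.sum_const, hcard, nsmul_eq_mul]
    have hle : Fintype.card ι ≤ n + m + 1 + 1 := by
      have := Fintype.card_le_of_injective f hf
      rwa [Fintype.card_fin] at this
    have hdesc' : ((n + m + 1 + 1 - Fintype.card ι : ℕ) : ℝ) *
        ((n + (m + 1) + 1).descFactorial (Fintype.card ι) : ℝ) =
        (n + m + 1 + 1) * (n + m + 1).descFactorial (Fintype.card ι) := by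
      exact_mod_cast hdesc
    -- Dividing by the number of admissible `e` fails only if the targets fill the whole word; then
    -- no `e` is admissible and both sides vanish.
    rcases hle.lt_or_eq with hlt | heq
    · have hne : ((n + m + 1 + 1 - Fintype.card ι : ℕ) : ℝ) ≠ 0 := by
        have : n + m + 1 + 1 - Fintype.card ι ≠ 0 := by omega
        exact_mod_cast this
      apply mul_left_cancel₀ hne
      calc _ = S * (((n + m + 1 + 1 - Fintype.card ι : ℕ) : ℝ) *
            ((n + (m + 1) + 1).descFactorial (Fintype.card ι) : ℝ)) := by ring
        _ = (S * (n + m + 1).descFactorial (Fintype.card ι)) * (n + m + 1 + 1) := by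
            rw [hdesc']; ring
        _ = _ := by
            rw [h1]
            have : ((n : ℝ) + m + 1 + 1) ≠ 0 := by positivity
            field_simp
    · have h0 : (n + 1).descFactorial (Fintype.card ι) = 0 :=
        Nat.descFactorial_eq_zero_iff_lt.2 (by omega)
      have hS0 : S = 0 := by
        rw [hcomm]
        refine Finset.sum_eq_zero fun e _ => Finset.sum_eq_zero fun g _ => ?_
        have hsurj : Function.Surjective f :=
          ((Fintype.bijective_iff_injective_and_card f).2 ⟨hf, by simp [heq]; omega⟩).2
        obtain ⟨i, hi⟩ := hsurj e
        have : {ω | ∀ i, e.succAbove (track (fun k => ξ k ω) n m (g i)) = f i} = ∅ :=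
          Set.eq_empty_of_forall_notMem fun ω hω => Fin.succAbove_ne e _ ((hω i).trans hi)
        simp [this]
      rw [hS0, h0]; simp

/-- One term of the sum in `sum_track` for single letters. The uniformity over `C` is what later
controls a threshold depending on the word at time `n + m`. -/
theorem UniformInnovations.prob_track_le (h : UniformInnovations F ξ P) (n m : ℕ)
    (j : Fin (n + 1)) (s : Fin (n + m + 1)) (C : Set Ω) (hC : MeasurableSet[F (n + m)] C) :
    P.real ({ω | track (fun k => ξ k ω) n m j = s} ∩ C) ≤
      (n + 1) / (n + m + 1) * P.real C := by
  have h1 := h.sum_track (ι := Unit) n m (fun _ => s) (fun _ _ _ => rfl) C hC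
  have h2 := Finset.single_le_sum (f := fun g : Unit → Fin (n + 1) =>
    P.real ({ω | ∀ i, track (fun k => ξ k ω) n m (g i) = s} ∩ C))
    (fun _ _ => measureReal_nonneg) (Finset.mem_univ fun _ => j)
  simp only [Fintype.card_unit, Nat.descFactorial_one, forall_const] at h1 h2
  rw [div_mul_eq_mul_div, le_div_iff₀ (by positivity)]
  push_cast at h1
  rw [← h1]
  exact mul_le_mul_of_nonneg_right h2 (by positivity)

/-- The first word has a single letter, so the sum in `sum_track` has one term and yields an
equality. -/
theorem UniformInnovations.prob_track_zero (h : UniformInnovations F ξ P) (m : ℕ)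
    (s : Fin (0 + m + 1)) (C : Set Ω) (hC : MeasurableSet[F (0 + m)] C) :
    P.real ({ω | track (fun k => ξ k ω) 0 m 0 = s} ∩ C) = P.real C / (m + 1) := by
  have h1 := h.sum_track (ι := Unit) 0 m (fun _ => s) (fun _ _ _ => rfl) C hC
  have h2 : ∀ g : Unit → Fin (0 + 1), g = fun _ => 0 := fun g => funext fun _ =>
    Subsingleton.elim (α := Fin 1) _ _
  rw [Fintype.sum_eq_single (fun _ => 0) fun g hg => absurd (h2 g) hg] at h1
  simp only [Fintype.card_unit, Nat.descFactorial_one, forall_const] at h1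
  rw [eq_div_iff (by positivity)]
  push_cast at h1
  linarith

theorem UniformInnovations.prob_track_pair_le (h : UniformInnovations F ξ P) (n m : ℕ)
    (i j : Fin (n + 1)) (s t : Fin (n + m + 1)) (hst : s ≠ t) :
    P.real {ω | track (fun k => ξ k ω) n m i = s ∧ track (fun k => ξ k ω) n m j = t} *
      ((n + m + 1) * (n + m)) ≤ (n + 1) * n := by
  have h1 := h.sum_track (ι := Fin 2) n m ![s, t] (by
    intro a b hab
    fin_cases a <;> fin_cases b <;> simp_all) Set.univ MeasurableSet.univ
  have h2 := Finset.single_le_sum (f := fun g : Fin 2 → Fin (n + 1) =>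
    P.real ({ω | ∀ i, track (fun k => ξ k ω) n m (g i) = ![s, t] i} ∩ Set.univ))
    (fun _ _ => measureReal_nonneg) (Finset.mem_univ ![i, j])
  have h3 : ∀ k : ℕ, (k + 1).descFactorial 2 = (k + 1) * k := by
    intro k; simp [Nat.descFactorial_succ, mul_comm]
  simp only [Fintype.card_fin, Set.inter_univ, Fin.forall_fin_two, h3] at h1 h2
  simp only [probReal_univ, mul_one] at h1
  push_cast at h1
  rw [← h1]
  exact mul_le_mul_of_nonneg_right h2 (by positivity)

end Innovations

/-! ### Convergence of relative positions. -/

section Limit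

variable {Ω : Type*} {m₀ : MeasurableSpace Ω} {P : Measure Ω}
  {F : ℕ → MeasurableSpace Ω} {ξ : ∀ n : ℕ, Ω → Fin (n + 1)}

/-- Exactly `k + 1` of the `n + 2` insertion places push position `k` up by one. -/
theorem sum_succAbove_add_one {n : ℕ} (k : Fin (n + 1)) :
    ∑ e : Fin (n + 2), (((e.succAbove k : ℕ) : ℝ) + 1) = (k + 1) * (n + 3) := by
  have h1 : ∀ e : Fin (n + 2), (((e.succAbove k : ℕ) : ℝ) + 1) =
      ((k : ℝ) + 1) + if e ∈ Finset.Iic k.castSucc then 1 else 0 := by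
    intro e
    by_cases he : e ≤ k.castSucc
    · rw [Fin.succAbove_of_le_castSucc _ _ he, if_pos (Finset.mem_Iic.2 he)]
      simp
    · rw [Fin.succAbove_of_castSucc_lt _ _ (not_le.1 he),
        if_neg (fun h' => he (Finset.mem_Iic.1 h'))]
      simp
  rw [Finset.sum_congr rfl fun e _ => h1 e, Finset.sum_add_distrib, Finset.sum_ite_mem,
    Finset.univ_inter]
  simp only [Finset.sum_const, Finset.card_univ, Fintype.card_fin, Fin.card_Iic, nsmul_eq_mul]
  push_cast [Fin.val_castSucc]
  ring

theorem UniformInnovations.integral_comp [IsProbabilityMeasure P]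
    (h : UniformInnovations F ξ P) (n : ℕ)
    (g : Fin (n + 1) → ℝ) : ∫ ω, g (ξ n ω) ∂P = (∑ e, g e) / (n + 1) := by
  have := Measure.isProbabilityMeasure_map (μ := P) (h.measurable n).aemeasurable
  rw [← integral_map (h.measurable n).aemeasurable (f := g)
    (Measurable.of_discrete (f := g)).aestronglyMeasurable, integral_fintype (.of_finite),
    Finset.sum_div]
  refine Finset.sum_congr rfl fun e _ => ?_
  rw [map_measureReal_apply (h.measurable n) (measurableSet_singleton e), h.prob_singleton,
    smul_eq_mul]
  ring

/-- The position of a letter, relative to the length of the word. -/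
noncomputable def relPos (ξ : ∀ n : ℕ, Ω → Fin (n + 1)) (n m : ℕ) (i : Fin (n + 1)) (ω : Ω) : ℝ :=
  ((track (fun k => ξ k ω) n m i : ℕ) + 1) / (n + m + 2)

theorem relPos_nonneg (n m : ℕ) (i : Fin (n + 1)) (ω : Ω) : 0 ≤ relPos ξ n m i ω := by
  unfold relPos; positivity

theorem relPos_le_one (n m : ℕ) (i : Fin (n + 1)) (ω : Ω) : relPos ξ n m i ω ≤ 1 := by
  unfold relPos
  rw [div_le_one (by positivity)]
  have := (track (fun k => ξ k ω) n m i).isLt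
  have : ((track (fun k => ξ k ω) n m i : ℕ) : ℝ) ≤ (n + m : ℕ) := by
    exact_mod_cast Nat.le_of_lt_succ this
  push_cast at this
  linarith

theorem UniformInnovations.measurable_relPos (h : UniformInnovations F ξ P) (n m : ℕ)
    (i : Fin (n + 1)) : Measurable (relPos ξ n m i) :=
  (measurable_of_finite fun k : Fin (n + m + 1) => (((k : ℕ) : ℝ) + 1) / (n + m + 2)).comp
    (h.measurable_track n m i)

/-- The forward filtration generated by the innovations up to time `n + m`. -/
def forwardFiltration (h : UniformInnovations F ξ P) (n : ℕ) : Filtration ℕ m₀ where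
  seq m := ⨆ k ≤ n + m, MeasurableSpace.comap (ξ k) inferInstance
  mono' _ _ hij := iSup₂_le fun k hk =>
    le_iSup₂_of_le k (hk.trans (Nat.add_le_add_left hij n)) le_rfl
  le' _ := iSup₂_le fun k _ => (h.measurable k).comap_le

theorem UniformInnovations.measurable_track_forward (h : UniformInnovations F ξ P) (n m : ℕ)
    (j : Fin (n + 1)) :
    Measurable[forwardFiltration h n m] fun ω => track (fun k => ξ k ω) n m j := by
  induction m with
  | zero => exact measurable_const
  | succ m ih =>
    have h1 : Measurable[forwardFiltration h n (m + 1)] (ξ (n + m + 1)) :=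
      Measurable.of_comap_le (le_iSup₂_of_le (n + m + 1) le_rfl le_rfl)
    have h2 := ih.mono ((forwardFiltration h n).mono (Nat.le_succ m)) le_rfl
    exact (measurable_of_finite fun p : Fin (n + m + 1 + 1) × Fin (n + m + 1) =>
      p.1.succAbove p.2).comp (@Measurable.prodMk _ _ _ _ _ (_) _ _ h1 h2)

/-- A uniform insertion multiplies the expected position, counted from one, by the ratio of the
successive values of length plus one. This is why `relPos` has `+ 1` above and `n + m + 2` below. -/
theorem UniformInnovations.martingale_relPos [IsProbabilityMeasure P]
    (h : UniformInnovations F ξ P) (n : ℕ)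
    (i : Fin (n + 1)) : Martingale (fun m => relPos ξ n m i) (forwardFiltration h n) P := by
  have hint : ∀ m, Integrable (relPos ξ n m i) P := fun m =>
    Integrable.of_bound (h.measurable_relPos n m i).aestronglyMeasurable 1
      (ae_of_all _ fun ω => by
        rw [Real.norm_of_nonneg (relPos_nonneg n m i ω)]; exact relPos_le_one n m i ω)
  refine martingale_nat (fun m => ?_) hint fun m => ?_
  · exact ((measurable_of_finite fun k : Fin (n + m + 1) =>
      (((k : ℕ) : ℝ) + 1) / (n + m + 2)).comp
      (h.measurable_track_forward n m i)).stronglyMeasurable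
  · have hle : forwardFiltration h n m ≤ m₀ := (forwardFiltration h n).le m
    let u : Fin (n + m + 1) → Ω → ℝ := fun k =>
      Set.indicator {ω | track (fun k => ξ k ω) n m i = k} 1
    let v : Fin (n + m + 1) → Ω → ℝ := fun k ω =>
      (((ξ (n + m + 1) ω).succAbove k : ℕ) + 1) / (n + m + 3)
    have h1 : Measurable[forwardFiltration h n m] (1 : Ω → ℝ) := @measurable_const _ _ _ (_) 1
    have hu : ∀ k, Measurable[forwardFiltration h n m] (u k) := fun k =>
      Measurable.indicator (m := forwardFiltration h n m) h1 (h.measurable_track_forward n m i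
        (measurableSet_singleton k))
    have hvm : ∀ k, Measurable[MeasurableSpace.comap (ξ (n + m + 1)) inferInstance] (v k) :=
      fun k => (measurable_of_finite fun e : Fin (n + m + 1 + 1) =>
        (((e.succAbove k : ℕ) : ℝ) + 1) / (n + m + 3)).comp (comap_measurable _)
    have hv : ∀ k, Integrable (v k) P := fun k =>
      (Integrable.of_finite (f := fun e : Fin (n + m + 1 + 1) =>
        (((e.succAbove k : ℕ) : ℝ) + 1) / (n + m + 3)) (μ := P.map (ξ (n + m + 1)))
        |>.comp_measurable (h.measurable _) :)
    have hub : ∀ k, ∀ᵐ ω ∂P, ‖u k ω‖ ≤ 1 := fun k => ae_of_all _ fun ω => by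
      simp only [u, Set.indicator_apply]; split_ifs <;> simp
    have hind : Indep (MeasurableSpace.comap (ξ (n + m + 1)) inferInstance)
        (forwardFiltration h n m) P := by
      have := indep_iSup_of_disjoint (fun k => (h.measurable k).comap_le)
        h.iIndepFun.iIndep (S := {n + m + 1}) (T := {k | k ≤ n + m}) (by simp)
      simpa [forwardFiltration] using this
    -- Splitting by the current position `k` makes each term a product of a factor known at time `m`
    -- and a function of the new innovation, independent of the past.
    have hsum : relPos ξ n (m + 1) i = ∑ k, u k * v k := by
      ext ω
      rw [Finset.sum_apply, Finset.sum_eq_single (track (fun k => ξ k ω) n m i)]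
      · simp only [u, v, Pi.mul_apply, Set.indicator_apply, relPos, track_succ]
        simp
        ring
      · intro k _ hk
        simp [u, Ne.symm hk]
      · simp
    have hterm : ∀ k, P[u k * v k | forwardFiltration h n m] =ᵐ[P]
        fun ω => u k ω * ((k + 1) / (n + m + 2)) := by
      intro k
      have e1 := condExp_stronglyMeasurable_mul_of_bound hle (hu k).stronglyMeasurable (hv k) 1
        (hub k)
      have e2 := condExp_indep_eq (h.measurable (n + m + 1)).comap_le hle
        (hvm k).stronglyMeasurable hind
      have e3 : ∫ ω, v k ω ∂P = ((k : ℕ) + 1) / (n + m + 2) := by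
        have := h.integral_comp (n + m + 1) fun e => (((e.succAbove k : ℕ) : ℝ) + 1) / (n + m + 3)
        refine this.trans ?_
        rw [← Finset.sum_div, sum_succAbove_add_one]
        push_cast
        have h3 : ((n : ℝ) + m + 3) ≠ 0 := by positivity
        have h4 : ((n : ℝ) + m + 1 + 1) ≠ 0 := by positivity
        have h5 : ((n : ℝ) + m + 2) ≠ 0 := by positivity
        field_simp
        ring
      filter_upwards [e1, e2] with ω h1 h2
      rw [h1, Pi.mul_apply, h2, e3]
    have hint' : ∀ k ∈ Finset.univ, Integrable (u k * v k) P := fun k _ =>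
      (hv k).bdd_mul ((hu k).mono hle le_rfl).aestronglyMeasurable (hub k)
    rw [hsum]
    filter_upwards [condExp_finsetSum hint' (forwardFiltration h n m), ae_all_iff.2 hterm]
      with ω h1 h2
    rw [h1, Finset.sum_apply, Finset.sum_congr rfl fun k _ => h2 k,
      Finset.sum_eq_single (track (fun k => ξ k ω) n m i)]
    · simp [u, relPos]
    · intro k _ hk
      simp [u, Ne.symm hk]
    · simp

/-- The limiting relative position of a letter. -/
noncomputable def limPos (ξ : ∀ n : ℕ, Ω → Fin (n + 1)) (n : ℕ) (i : Fin (n + 1)) (ω : Ω) : ℝ :=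
  -- The limsup is defined and measurable everywhere; it is the limit almost surely.
  limsup (fun m => relPos ξ n m i ω) atTop

theorem UniformInnovations.tendsto_limPos [IsProbabilityMeasure P]
    (h : UniformInnovations F ξ P) (n : ℕ)
    (i : Fin (n + 1)) :
    ∀ᵐ ω ∂P, Tendsto (fun m => relPos ξ n m i ω) atTop (𝓝 (limPos ξ n i ω)) := by
  have := (h.martingale_relPos n i).submartingale.exists_ae_tendsto_of_bdd (R := 1) fun m => by
    refine (eLpNorm_le_of_ae_bound (C := 1) (ae_of_all _ fun ω => ?_)).trans ?_
    · rw [Real.norm_of_nonneg (relPos_nonneg n m i ω)]; exact relPos_le_one n m i ω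
    · simp
  filter_upwards [this] with ω hω
  obtain ⟨c, hc⟩ := hω
  rw [limPos, hc.limsup_eq]
  exact hc

theorem UniformInnovations.measurable_limPos (h : UniformInnovations F ξ P) (n : ℕ)
    (i : Fin (n + 1)) : Measurable (limPos ξ n i) :=
  Measurable.limsup fun m => h.measurable_relPos n m i

end Limit

/-! ### Limiting positions have no atoms and are distinct. -/

section AntiConcentration

variable {Ω : Type*} {m₀ : MeasurableSpace Ω} {P : Measure Ω} [IsProbabilityMeasure P]
  {F : ℕ → MeasurableSpace Ω} {ξ : ∀ n : ℕ, Ω → Fin (n + 1)}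

theorem card_le_of_abs_sub_le {k : ℕ} (S : Finset (Fin k)) (y r : ℝ) (hr : 0 ≤ r)
    (hS : ∀ s ∈ S, |((s : ℕ) : ℝ) - y| ≤ r) : (S.card : ℝ) ≤ 2 * r + 1 := by
  rcases S.eq_empty_or_nonempty with rfl | hne
  · simp; positivity
  · have hsub : S ⊆ Finset.Icc (S.min' hne) (S.max' hne) := fun s hs =>
      Finset.mem_Icc.2 ⟨S.min'_le s hs, S.le_max' s hs⟩
    have h1 := Finset.card_le_card hsub
    rw [Fin.card_Icc] at h1
    have h2 := abs_le.1 (hS _ (S.min'_mem hne))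
    have h3 := abs_le.1 (hS _ (S.max'_mem hne))
    have h4 : S.card + (S.min' hne : ℕ) ≤ (S.max' hne : ℕ) + 1 := by
      have : (S.min' hne : ℕ) ≤ S.max' hne := S.min'_le _ (S.max'_mem hne)
      omega
    have h5 : (S.card : ℝ) + (S.min' hne : ℕ) ≤ (S.max' hne : ℕ) + 1 := by exact_mod_cast h4
    linarith

/-- Where `Y` vanishes, either `X m` is below `δ` in absolute value or it is at least `δ` away from
its limit; the latter has vanishing probability. Then let `δ` tend to zero. -/
theorem ae_ne_zero_of_tendsto {X : ℕ → Ω → ℝ} {Y : Ω → ℝ} (hX : ∀ m, Measurable (X m))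
    (hlim : ∀ᵐ ω ∂P, Tendsto (fun m => X m ω) atTop (𝓝 (Y ω))) (K : ℝ)
    (hK : ∀ δ > 0, ∀ᶠ m in atTop, P.real {ω | |X m ω| < δ} ≤ K * δ) : ∀ᵐ ω ∂P, Y ω ≠ 0 := by
  have hmeas := tendstoInMeasure_of_tendsto_ae (fun m => (hX m).aestronglyMeasurable) hlim
  have hbound : ∀ δ > 0, P.real {ω | Y ω = 0} ≤ K * δ := by
    intro δ hδ
    have h1 := tendstoInMeasure_iff_norm.1 hmeas δ hδ
    have h2 : Tendsto (fun m => K * δ + P.real {ω | δ ≤ ‖X m ω - Y ω‖}) atTop (𝓝 (K * δ)) := by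
      have := (ENNReal.tendsto_toReal ENNReal.zero_ne_top).comp h1
      simpa [Measure.real] using tendsto_const_nhds (x := K * δ) |>.add this
    refine ge_of_tendsto h2 ?_
    filter_upwards [hK δ hδ] with m hm
    refine (measureReal_mono ?_).trans ((measureReal_union_le _ _).trans
      (add_le_add_left hm (P.real {ω | δ ≤ ‖X m ω - Y ω‖})))
    intro ω hω
    have hω' : Y ω = 0 := hω
    by_cases h : |X m ω| < δ
    · exact Or.inl h
    · refine Or.inr ?_
      change δ ≤ ‖X m ω - Y ω‖
      rw [hω', sub_zero, Real.norm_eq_abs]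
      exact not_lt.1 h
  have h0 : P.real {ω | Y ω = 0} ≤ 0 := by
    have : Tendsto (fun δ => K * δ) (𝓝[>] (0 : ℝ)) (𝓝 0) := by
      have : Tendsto (fun δ => K * δ) (𝓝 (0 : ℝ)) (𝓝 (K * 0)) := tendsto_id.const_mul K
      rw [mul_zero] at this
      exact this.mono_left nhdsWithin_le_nhds
    exact ge_of_tendsto this (eventually_mem_nhdsWithin.mono fun δ hδ => hbound δ hδ)
  have h1 := le_antisymm h0 measureReal_nonneg
  rw [measureReal_eq_zero_iff] at h1
  exact measure_eq_zero_iff_ae_notMem.1 h1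

/-- The left side bounds the number of positions in a window of relative radius `δ`; any factor
above 2 eventually absorbs the additive terms. -/
theorem eventually_mul_le_mul (n : ℕ) {δ : ℝ} (hδ : 0 < δ) :
    ∀ᶠ m : ℕ in atTop, 2 * (δ * (n + m + 2)) + 1 ≤ 5 * δ * ((n : ℝ) + m) := by
  have h : Tendsto (fun m : ℕ => (m : ℝ)) atTop atTop := tendsto_natCast_atTop_atTop
  filter_upwards [h.eventually_ge_atTop (4 + 1 / δ)] with m hm
  have h1 : δ * (4 + 1 / δ) ≤ δ * m := mul_le_mul_of_nonneg_left hm hδ.le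
  have h2 : δ * (4 + 1 / δ) = 4 * δ + 1 := by field_simp
  have h3 : (0 : ℝ) ≤ δ * n := by positivity
  nlinarith

/-- About `2δN` positions lie within relative distance `δ` of `x`, each of mass O(1/N). -/
theorem UniformInnovations.limPos_ne_const (h : UniformInnovations F ξ P) (n : ℕ)
    (i : Fin (n + 1)) (x : ℝ) : ∀ᵐ ω ∂P, limPos ξ n i ω ≠ x := by
  have := ae_ne_zero_of_tendsto (P := P) (X := fun m ω => relPos ξ n m i ω - x)
    (Y := fun ω => limPos ξ n i ω - x) (fun m => (h.measurable_relPos n m i).sub_const x)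
    ((h.tendsto_limPos n i).mono fun ω hω => hω.sub_const x) (5 * (n + 1)) fun δ hδ => by
      filter_upwards [eventually_mul_le_mul n hδ] with m hm
      classical
      let S : Finset (Fin (n + m + 1)) :=
        Finset.univ.filter fun s => |((s : ℕ) + 1 : ℝ) / (n + m + 2) - x| < δ
      have hS : (S.card : ℝ) ≤ 2 * (δ * (n + m + 2)) + 1 := by
        refine card_le_of_abs_sub_le S (x * (n + m + 2) - 1) _ (by positivity) fun s hs => ?_
        have h1 := (Finset.mem_filter.1 hs).2
        have hpos : (0 : ℝ) < n + m + 2 := by positivity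
        have h2 : ((s : ℕ) : ℝ) - (x * (n + m + 2) - 1) =
            (((s : ℕ) + 1 : ℝ) / (n + m + 2) - x) * (n + m + 2) := by field_simp; ring
        rw [h2, abs_mul, abs_of_pos hpos]
        exact (mul_lt_mul_of_pos_right h1 hpos).le
      have hsub : {ω | |relPos ξ n m i ω - x| < δ} ⊆
          ⋃ s ∈ S, {ω | track (fun k => ξ k ω) n m i = s} := by
        intro ω hω
        simp only [Set.mem_iUnion]
        exact ⟨track (fun k => ξ k ω) n m i, Finset.mem_filter.2 ⟨Finset.mem_univ _, hω⟩, rfl⟩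
      calc P.real {ω | |relPos ξ n m i ω - x| < δ}
          ≤ ∑ s ∈ S, P.real {ω | track (fun k => ξ k ω) n m i = s} :=
            (measureReal_mono hsub (measure_ne_top _ _)).trans (measureReal_biUnion_finset_le _ _)
        _ ≤ ∑ s ∈ S, ((n + 1) / (n + m + 1) : ℝ) := Finset.sum_le_sum fun s _ => by
            simpa using h.prob_track_le n m i s Set.univ MeasurableSet.univ
        _ = S.card * ((n + 1) / (n + m + 1) : ℝ) := by rw [Finset.sum_const, nsmul_eq_mul]
        _ ≤ (5 * δ * (n + m)) * ((n + 1) / (n + m + 1) : ℝ) :=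
            mul_le_mul_of_nonneg_right (hS.trans hm) (by positivity)
        _ ≤ 5 * (n + 1) * δ := by
            rw [mul_div_assoc', div_le_iff₀ (by positivity)]
            have : 0 ≤ δ * ((n : ℝ) + 1) := by positivity
            nlinarith
  exact this.mono fun ω hω h' => hω (sub_eq_zero.2 h')

/-- There are O(δN²) pairs of distinct positions within relative distance `δ`, each of mass O(1/N²).
-/
theorem UniformInnovations.limPos_ne (h : UniformInnovations F ξ P) (n : ℕ)
    {i j : Fin (n + 1)} (hij : i ≠ j) : ∀ᵐ ω ∂P, limPos ξ n i ω ≠ limPos ξ n j ω := by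
  have := ae_ne_zero_of_tendsto (P := P) (X := fun m ω => relPos ξ n m i ω - relPos ξ n m j ω)
    (Y := fun ω => limPos ξ n i ω - limPos ξ n j ω)
    (fun m => (h.measurable_relPos n m i).sub (h.measurable_relPos n m j))
    (by filter_upwards [h.tendsto_limPos n i, h.tendsto_limPos n j] with ω h1 h2 using h1.sub h2)
    (5 * ((n + 1) * n)) fun δ hδ => by
      filter_upwards [eventually_mul_le_mul n hδ, eventually_ge_atTop 1] with m hm hm1
      classical
      let S : Fin (n + m + 1) → Finset (Fin (n + m + 1)) := fun s =>
        Finset.univ.filter fun t => s ≠ t ∧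
          |((s : ℕ) + 1 : ℝ) / (n + m + 2) - ((t : ℕ) + 1 : ℝ) / (n + m + 2)| < δ
      have hS : ∀ s, ((S s).card : ℝ) ≤ 2 * (δ * (n + m + 2)) + 1 := by
        intro s
        refine card_le_of_abs_sub_le (S s) s _ (by positivity) fun t ht => ?_
        have h1 := (Finset.mem_filter.1 ht).2.2
        have hpos : (0 : ℝ) < n + m + 2 := by positivity
        have h2 : ((t : ℕ) : ℝ) - (s : ℕ) = -((((s : ℕ) + 1 : ℝ) / (n + m + 2) -
            ((t : ℕ) + 1 : ℝ) / (n + m + 2)) * (n + m + 2)) := by field_simp; ring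
        rw [h2, abs_neg, abs_mul, abs_of_pos hpos]
        exact (mul_lt_mul_of_pos_right h1 hpos).le
      have hsub : {ω | |relPos ξ n m i ω - relPos ξ n m j ω| < δ} ⊆
          ⋃ s ∈ Finset.univ, ⋃ t ∈ S s, {ω | track (fun k => ξ k ω) n m i = s ∧
            track (fun k => ξ k ω) n m j = t} := by
        intro ω hω
        simp only [Set.mem_iUnion]
        exact ⟨track (fun k => ξ k ω) n m i, Finset.mem_univ _, track (fun k => ξ k ω) n m j,
          Finset.mem_filter.2 ⟨Finset.mem_univ _,
            (strictMono_track _ n m).injective.ne hij, hω⟩, rfl, rfl⟩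
      have hm1' : (1 : ℝ) ≤ m := by exact_mod_cast hm1
      have hpos : (0 : ℝ) < (n + m + 1) * (n + m) := by positivity
      calc P.real {ω | |relPos ξ n m i ω - relPos ξ n m j ω| < δ}
          ≤ ∑ s, P.real (⋃ t ∈ S s, {ω | track (fun k => ξ k ω) n m i = s ∧
            track (fun k => ξ k ω) n m j = t}) :=
            (measureReal_mono hsub (measure_ne_top _ _)).trans (measureReal_biUnion_finset_le _ _)
        _ ≤ ∑ s, ∑ t ∈ S s, P.real {ω | track (fun k => ξ k ω) n m i = s ∧
            track (fun k => ξ k ω) n m j = t} :=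
            Finset.sum_le_sum fun s _ => measureReal_biUnion_finset_le _ _
        _ ≤ ∑ s, ∑ t ∈ S s, ((n + 1) * n / ((n + m + 1) * (n + m)) : ℝ) :=
            Finset.sum_le_sum fun s _ => Finset.sum_le_sum fun t ht => by
              rw [le_div_iff₀ hpos]
              exact h.prob_track_pair_le n m i j s t (Finset.mem_filter.1 ht).2.1
        _ = ∑ s, ((S s).card : ℝ) * ((n + 1) * n / ((n + m + 1) * (n + m)) : ℝ) := by
            simp only [Finset.sum_const, nsmul_eq_mul]
        _ ≤ ∑ _s : Fin (n + m + 1), (5 * δ * (n + m)) *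
              ((n + 1) * n / ((n + m + 1) * (n + m)) : ℝ) :=
            Finset.sum_le_sum fun s _ =>
              mul_le_mul_of_nonneg_right ((hS s).trans hm) (by positivity)
        _ = 5 * ((n + 1) * n) * δ := by
            rw [Finset.sum_const, Finset.card_univ, Fintype.card_fin, nsmul_eq_mul]
            push_cast
            have h1 : ((n : ℝ) + m + 1) ≠ 0 := by positivity
            have h2 : ((n : ℝ) + m) ≠ 0 := by positivity
            field_simp
  exact this.mono fun ω hω h' => hω (sub_eq_zero.2 h')

theorem UniformInnovations.strictMono_limPos (h : UniformInnovations F ξ P) (n : ℕ) :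
    ∀ᵐ ω ∂P, StrictMono fun i => limPos ξ n i ω := by
  have h1 : ∀ᵐ ω ∂P, ∀ i j : Fin (n + 1), i ≠ j → limPos ξ n i ω ≠ limPos ξ n j ω :=
    ae_all_iff.2 fun i => ae_all_iff.2 fun j => by
      by_cases hij : i = j
      · exact ae_of_all _ fun ω h' => absurd hij h'
      · exact (h.limPos_ne n hij).mono fun ω hω _ => hω
  filter_upwards [h1, ae_all_iff.2 fun i => h.tendsto_limPos n i] with ω hne hlim i j hij
  refine lt_of_le_of_ne (le_of_tendsto_of_tendsto' (hlim i) (hlim j) fun m => ?_) (hne i j hij.ne)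
  have : ((track (fun k => ξ k ω) n m i : ℕ) : ℝ) ≤ (track (fun k => ξ k ω) n m j : ℕ) := by
    exact_mod_cast (strictMono_track (fun k => ξ k ω) n m hij).le
  unfold relPos
  gcongr

end AntiConcentration

theorem measurable_comp₂ {Ω α β γ : Type*} {G : MeasurableSpace Ω} [MeasurableSpace α]
    [MeasurableSpace β] [MeasurableSpace γ] [Countable α] [Countable β]
    [MeasurableSingletonClass α] [MeasurableSingletonClass β] (g : α → β → γ) {f : Ω → α}
    {k : Ω → β} (hf : Measurable[G] f) (hk : Measurable[G] k) :
    Measurable[G] fun ω => g (f ω) (k ω) :=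
  (Measurable.of_discrete (f := fun p : α × β => g p.1 p.2)).comp (hf.prodMk hk)

/-! ### Sorted erasers as innovations, and lexicographic events. -/

section SortedErasers

variable {Ω : Type*} {m₀ : MeasurableSpace Ω} {P : Measure Ω} [IsProbabilityMeasure P]
  {A : Type*} [Fintype A] [LinearOrder A] [MeasurableSpace A] [MeasurableSingletonClass A]
  {W : ∀ n : ℕ, Ω → Fin (n + 1) → A} {η : ∀ n : ℕ, Ω → Fin (n + 1)}

omit [Fintype A] [LinearOrder A] [MeasurableSingletonClass A] [IsProbabilityMeasure P] in
theorem IsGEWP.uniformInnovations_eraser (h : IsGEWP W η P) :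
    UniformInnovations (backwardFiltration W η) η P where
  le := h.backwardFiltration_le
  antitone := antitone_backwardFiltration
  measurable := h.measurable_eraser
  adapted _ := measurable_eraser_backwardFiltration le_rfl
  prob n e C hC := by
    have h1 := (Indep_iff _ _ _).1 (h.indep n) _ C ⟨{e}, measurableSet_singleton e, rfl⟩ hC
    have h2 : P (η n ⁻¹' {e}) = 1 / ((n + 1 : ℕ) : ENNReal) := by
      rw [← Measure.map_apply (h.measurable_eraser n) (measurableSet_singleton e), h.uniform n,
        uniformOn_univ]
      simp
    rw [measureReal_def, h1, h2, ENNReal.toReal_mul, ENNReal.toReal_div, ENNReal.toReal_natCast,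
      ← measureReal_def]
    push_cast
    rw [ENNReal.toReal_one]
    ring

theorem measurable_sortedEraser {G : MeasurableSpace Ω} {n : ℕ} (hW : Measurable[G] (W n))
    (hη : Measurable[G] (η n)) : Measurable[G] (sortedEraser W η n) :=
  measurable_comp₂ (fun w e => sortPerm w e) hW hη

theorem measurable_eraser_of_sortedEraser {G : MeasurableSpace Ω} {n : ℕ}
    (hW : Measurable[G] (W n)) (hη : Measurable[G] (sortedEraser W η n)) :
    Measurable[G] (η n) := by
  have h1 := measurable_comp₂ (fun w e => (sortPerm w).symm e) hW hη
  simpa only [sortedEraser, Equiv.symm_apply_apply] using h1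

/-- On each fibre `W n = w`, an event of F_n, the sorted eraser is the image of the uniform `η n`
under a fixed permutation. -/
theorem IsGEWP.uniformInnovations_sortedEraser (h : IsGEWP W η P) :
    UniformInnovations (backwardFiltration W η) (sortedEraser W η) P where
  le := h.backwardFiltration_le
  antitone := antitone_backwardFiltration
  measurable n := measurable_sortedEraser (h.measurable_word n) (h.measurable_eraser n)
  adapted n := measurable_sortedEraser (measurable_word_backwardFiltration (Nat.le_succ n))
    (measurable_eraser_backwardFiltration le_rfl)
  prob n e C hC := by
    rw [measureReal_eq_sum_fiber (h.measurable_word n), measureReal_eq_sum_fiber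
      (h.measurable_word n) C, Finset.sum_div]
    refine Finset.sum_congr rfl fun w _ => ?_
    have h1 := h.uniformInnovations_eraser.prob n ((sortPerm w).symm e) (W n ⁻¹' {w} ∩ C)
      ((measurable_word_backwardFiltration le_rfl (measurableSet_singleton w)).inter hC)
    rw [← h1]
    congr 1
    ext ω
    simp only [Set.mem_inter_iff, Set.mem_preimage, Set.mem_singleton_iff, sortedEraser]
    constructor
    · rintro ⟨rfl, rfl, h3⟩; exact ⟨by simp, rfl, h3⟩
    · rintro ⟨h3, rfl, h4⟩; exact ⟨rfl, by simp [h3], h4⟩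

theorem IsGEWP.isLocalInnovations_sortedEraser (h : IsGEWP W η P) :
    IsLocalInnovations (backwardFiltration W η) (sortedEraser W η) P where
  measurable := h.uniformInnovations_sortedEraser.measurable
  indep := h.uniformInnovations_sortedEraser.indep
  uniform n := ⟨Set.univ, Set.finite_univ, Set.univ_nonempty,
    h.uniformInnovations_sortedEraser.map_eq n⟩
  ae_eq n := by
    set H := MeasurableSpace.comap (sortedEraser W η (n + 1)) inferInstance ⊔
      backwardFiltration W η (n + 1) with hH
    have hle : H ≤ completion P H := le_eventuallyMeasurableSpace
    refine ⟨aeSubfield_iff.2 ?_, aeSubfield_iff.2 ?_⟩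
    · have hW1 : ∀ k ≥ n + 1, Measurable[H] (W k) := fun k hk =>
        (measurable_word_backwardFiltration (η := η) hk).mono le_sup_right le_rfl
      have hη1 : Measurable[H] (η (n + 1)) := measurable_eraser_of_sortedEraser (hW1 _ le_rfl)
        (Measurable.of_comap_le le_sup_left)
      have hη : ∀ k ≥ n, Measurable[H] (η (k + 1)) := by
        intro k hk
        rcases hk.eq_or_lt with rfl | hk
        · exact hη1
        · exact (measurable_eraser_backwardFiltration (W := W) hk).mono le_sup_right le_rfl
      -- The completion is needed only here: the erasing relation holds almost surely.
      have hW0 : Measurable[completion P H] (W n) := by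
        refine measurable_completion_congr ?_ (h.erase n)
        refine Measurable.mono ?_ hle le_rfl
        exact measurable_comp₂ (fun w (e : Fin (n + 1 + 1)) => e.removeNth w) (hW1 _ le_rfl) hη1
      refine iSup₂_le fun k hk => sup_le ?_ ?_
      · rcases hk.eq_or_lt with rfl | hk
        · exact hW0.comap_le
        · exact ((hW1 k hk).mono hle le_rfl).comap_le
      · exact ((hη k hk).mono hle le_rfl).comap_le
    · exact (sup_le (h.uniformInnovations_sortedEraser.adapted n).comap_le
        (antitone_backwardFiltration (Nat.le_succ n))).trans le_eventuallyMeasurableSpace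

/-- The number of letters of `w` that come before the letter `a` at relative position `x` in the
lexicographic order on letters and positions. -/
noncomputable def lexCount {N : ℕ} (a : A) (x : ℝ) (w : Fin (N + 1) → A) : ℕ :=
  open scoped Classical in
  (Finset.univ.filter fun k : Fin (N + 1) =>
    w k < a ∨ w k = a ∧ (((k : ℕ) : ℝ) + 1) / (N + 2) ≤ x).card

omit [Fintype A] [MeasurableSpace A] [MeasurableSingletonClass A] in
theorem sortPerm_lt_lexCount_iff {N : ℕ} (a : A) (x : ℝ) (w : Fin (N + 1) → A) (k : Fin (N + 1)) :
    (sortPerm w k : ℕ) < lexCount a x w ↔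
      w k < a ∨ w k = a ∧ (((k : ℕ) : ℝ) + 1) / (N + 2) ≤ x := by
  classical
  rw [lexCount, sortPerm_lt_card_iff]
  · simp
  · intro k l hl hkl
    simp only [Finset.mem_filter, Finset.mem_univ, true_and] at hl ⊢
    rcases hkl with hkl | ⟨hkl, hlt⟩
    · rcases hl with hl | ⟨hl, -⟩
      · exact Or.inl (hkl.trans hl)
      · exact Or.inl (hkl.trans_eq hl)
    · rw [hkl]
      refine hl.imp_right fun hl => ⟨hl.1, le_trans ?_ hl.2⟩
      have : ((k : ℕ) : ℝ) ≤ (l : ℕ) := by exact_mod_cast hlt.le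
      gcongr

/-- The event that the `j`-th letter of the sorted word `W_n` comes before the letter `a` at
relative position `x` when its position is taken at time `n + m`. -/
def lexEvent (W : ∀ n : ℕ, Ω → Fin (n + 1) → A) (η : ∀ n : ℕ, Ω → Fin (n + 1)) (a : A) (x : ℝ)
    (n m : ℕ) (j : Fin (n + 1)) : Set Ω :=
  {ω | W n ω (Tuple.sort (W n ω) j) < a ∨ W n ω (Tuple.sort (W n ω) j) = a ∧
    relPos η n m (Tuple.sort (W n ω) j) ω ≤ x}

/-- The event that the `j`-th letter of the sorted word `W_n` comes before the letter `a` at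
relative position `x` when its limiting position is taken. -/
def limLexEvent (W : ∀ n : ℕ, Ω → Fin (n + 1) → A) (η : ∀ n : ℕ, Ω → Fin (n + 1)) (a : A) (x : ℝ)
    (n : ℕ) (j : Fin (n + 1)) : Set Ω :=
  {ω | W n ω (Tuple.sort (W n ω) j) < a ∨ W n ω (Tuple.sort (W n ω) j) = a ∧
    limPos η n (Tuple.sort (W n ω) j) ω ≤ x}

omit [IsProbabilityMeasure P] [Fintype A] [MeasurableSingletonClass A] in
-- Tracking preserves the letter, and the letters at or before `(a, x)` fill an initial segment of
-- the sorted word. The left factor of the comparison depends on the sorted erasers only, the right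
-- one on the word at time `n + m` only.
theorem IsGEWP.lexEvent_ae_eq (h : IsGEWP W η P) (a : A) (x : ℝ) (n m : ℕ) (j : Fin (n + 1)) :
    lexEvent W η a x n m j =ᵐ[P] {ω | (track (fun k => sortedEraser W η k ω) n m j : ℕ) <
      lexCount a x (W (n + m) ω)} := by
  filter_upwards [ae_all_iff.2 h.erase] with ω hω
  have h1 := sortPerm_track (w := fun k => W k ω) (e := fun k => η k ω) hω n m
    (Tuple.sort (W n ω) j)
  have h2 := word_track (w := fun k => W k ω) (e := fun k => η k ω) hω n m
    (Tuple.sort (W n ω) j)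
  have h3 : sortPerm (W n ω) (Tuple.sort (W n ω) j) = j := by simp [sortPerm]
  rw [h3] at h1
  refine propext ?_
  change (W n ω (Tuple.sort (W n ω) j) < a ∨ W n ω (Tuple.sort (W n ω) j) = a ∧
    relPos η n m (Tuple.sort (W n ω) j) ω ≤ x) ↔
      (track (fun k => sortPerm (W k ω) (η k ω)) n m j : ℕ) < lexCount a x (W (n + m) ω)
  rw [← h1, sortPerm_lt_lexCount_iff, h2, relPos]
  push_cast
  rfl

omit [IsProbabilityMeasure P] in
theorem IsGEWP.measurableSet_limLexEvent (h : IsGEWP W η P) (a : A) (x : ℝ) (n : ℕ)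
    (j : Fin (n + 1)) : MeasurableSet (limLexEvent W η a x n j) := by
  have : limLexEvent W η a x n j = ⋃ w : Fin (n + 1) → A, W n ⁻¹' {w} ∩
      {ω | w (Tuple.sort w j) < a ∨ w (Tuple.sort w j) = a ∧ limPos η n (Tuple.sort w j) ω ≤ x} := by
    ext ω
    simp [limLexEvent]
  rw [this]
  refine MeasurableSet.iUnion fun w => (h.measurable_word n (measurableSet_singleton w)).inter ?_
  exact (MeasurableSet.const _).union ((MeasurableSet.const _).inter
    (measurableSet_le (h.uniformInnovations_eraser.measurable_limPos n _) measurable_const))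

omit [IsProbabilityMeasure P] in
theorem IsGEWP.measurableSet_lexEvent (h : IsGEWP W η P) (a : A) (x : ℝ) (n m : ℕ)
    (j : Fin (n + 1)) : MeasurableSet (lexEvent W η a x n m j) := by
  have : lexEvent W η a x n m j = ⋃ w : Fin (n + 1) → A, W n ⁻¹' {w} ∩
      {ω | w (Tuple.sort w j) < a ∨ w (Tuple.sort w j) = a ∧
        relPos η n m (Tuple.sort w j) ω ≤ x} := by
    ext ω
    simp [lexEvent]
  rw [this]
  refine MeasurableSet.iUnion fun w => (h.measurable_word n (measurableSet_singleton w)).inter ?_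
  exact (MeasurableSet.const _).union ((MeasurableSet.const _).inter
    (measurableSet_le (h.uniformInnovations_eraser.measurable_relPos n m _) measurable_const))

/-- Almost surely no limiting position equals `x`, so each comparison with `x` is eventually that of
the limit. -/
theorem IsGEWP.tendsto_lexEvent (h : IsGEWP W η P) (a : A) (x : ℝ) (n : ℕ) (j : Fin (n + 1)) :
    Tendsto (fun m => P (symmDiff (lexEvent W η a x n m j) (limLexEvent W η a x n j))) atTop
      (𝓝 0) := by
  have hU := h.uniformInnovations_eraser
  have key : ∀ᵐ ω ∂P, ∀ᶠ m in atTop,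
      ω ∈ symmDiff (lexEvent W η a x n m j) (limLexEvent W η a x n j) ↔ ω ∈ (∅ : Set Ω) := by
    filter_upwards [ae_all_iff.2 fun i => hU.tendsto_limPos n i,
      ae_all_iff.2 fun i => hU.limPos_ne_const n i x] with ω hlim hne
    set i := Tuple.sort (W n ω) j with hi
    have : ∀ᶠ m in atTop, (relPos η n m i ω ≤ x ↔ limPos η n i ω ≤ x) := by
      rcases lt_or_gt_of_ne (hne i) with hlt | hgt
      · filter_upwards [(hlim i).eventually_lt_const hlt] with m hm
        exact ⟨fun _ => hlt.le, fun _ => hm.le⟩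
      · filter_upwards [(hlim i).eventually_const_lt hgt] with m hm
        exact ⟨fun h' => absurd h' (not_le.2 hm), fun h' => absurd h' (not_le.2 hgt)⟩
    filter_upwards [this] with m hm
    have : ω ∈ lexEvent W η a x n m j ↔ ω ∈ limLexEvent W η a x n j := by
      change (_ ∨ _ ∧ relPos η n m i ω ≤ x) ↔ (_ ∨ _ ∧ limPos η n i ω ≤ x)
      rw [hm]
    rw [Set.mem_symmDiff]
    simp [this]
  have := tendsto_measure_of_ae_tendsto_indicator_of_isFiniteMeasure atTop MeasurableSet.empty
    (fun m => (h.measurableSet_lexEvent a x n m j).symmDiff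
      (h.measurableSet_limLexEvent a x n j)) key
  simpa using this

end SortedErasers

/-! ### Concentration of letter proportions. -/

section Concentration

variable {Ω : Type*} {m₀ : MeasurableSpace Ω} {P : Measure Ω} [IsProbabilityMeasure P]
  {A : Type*} [Fintype A] [LinearOrder A] [MeasurableSpace A] [MeasurableSingletonClass A]
  {W : ∀ n : ℕ, Ω → Fin (n + 1) → A} {η : ∀ n : ℕ, Ω → Fin (n + 1)}

/-- The proportion of letters of `W_N` that come before the letter `a` at relative position `x`. -/
noncomputable def lexFrac (W : ∀ n : ℕ, Ω → Fin (n + 1) → A) (a : A) (x : ℝ) (N : ℕ) (ω : Ω) : ℝ :=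
  lexCount a x (W N ω) / (N + 1)

omit [Fintype A] [MeasurableSpace A] [MeasurableSingletonClass A] in
theorem lexCount_le {N : ℕ} (a : A) (x : ℝ) (w : Fin (N + 1) → A) : lexCount a x w ≤ N + 1 := by
  classical
  exact (Finset.card_filter_le _ _).trans (by simp)

theorem measurable_lexFrac {G : MeasurableSpace Ω} {N : ℕ} (hW : Measurable[G] (W N)) (a : A)
    (x : ℝ) : Measurable[G] (lexFrac W a x N) :=
  (Measurable.of_discrete (f := fun w : Fin (N + 1) → A =>
    (lexCount a x w : ℝ) / (N + 1))).comp hW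

theorem IsGEWP.integrable_lexFrac (h : IsGEWP W η P) (a : A) (x : ℝ) (N : ℕ) :
    Integrable (lexFrac W a x N) P := by
  refine Integrable.of_bound
    (measurable_lexFrac (h.measurable_word _) a x).aestronglyMeasurable 1 (ae_of_all _ fun ω => ?_)
  unfold lexFrac
  rw [Real.norm_of_nonneg (by positivity), div_le_one (by positivity)]
  exact_mod_cast lexCount_le a x _

theorem abs_indicator_one_sub {Ω : Type*} (S T : Set Ω) (ω : Ω) :
    |S.indicator (1 : Ω → ℝ) ω - T.indicator 1 ω| = (symmDiff S T).indicator 1 ω := by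
  by_cases h1 : ω ∈ S <;> by_cases h2 : ω ∈ T <;> simp [Set.indicator, Set.mem_symmDiff, h1, h2]

theorem sum_indicator_lt {k c : ℕ} (hc : c ≤ k) :
    ∑ s : Fin k, (if (s : ℕ) < c then (1 : ℝ) else 0) = c := by
  rw [Fin.sum_univ_eq_sum_range (fun s => if s < c then (1 : ℝ) else 0), Finset.sum_ite,
    Finset.sum_const_zero, add_zero, Finset.sum_const, nsmul_eq_mul, mul_one]
  have : (Finset.range k).filter (fun s => s < c) = Finset.range c := by
    ext s; simp only [Finset.mem_filter, Finset.mem_range]; omega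
  rw [this, Finset.card_range]

/-- The sorted position at time `m` of the only letter of the first word is uniform and independent
of F_m, so it falls below the F_m-measurable count with conditional probability count over length.
-/
theorem IsGEWP.lexFrac_ae_eq_condExp (h : IsGEWP W η P) (a : A) (x : ℝ) (m : ℕ) :
    lexFrac W a x (0 + m) =ᵐ[P]
      P[(lexEvent W η a x 0 m 0).indicator 1 | backwardFiltration W η (0 + m)] := by
  have hle := h.backwardFiltration_le (0 + m)
  have hWm := measurable_word_backwardFiltration (W := W) (η := η) (le_refl (0 + m))
  have hint := h.integrable_lexFrac a x (0 + m)
  refine ae_eq_condExp_of_forall_setIntegral_eq hle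
    ((integrable_const (1 : ℝ)).indicator (h.measurableSet_lexEvent a x 0 m 0))
    (fun _ _ _ => hint.integrableOn) (fun C hC _ => ?_)
    (measurable_lexFrac hWm a x).stronglyMeasurable.aestronglyMeasurable
  have hS := h.uniformInnovations_sortedEraser
  let B : Fin (0 + m + 1) → Set Ω := fun s => {ω | (s : ℕ) < lexCount a x (W (0 + m) ω)}
  have hB : ∀ s, MeasurableSet[backwardFiltration W η (0 + m)] (B s) := fun s =>
    hWm (MeasurableSet.of_discrete (s := {w | (s : ℕ) < lexCount a x w}))
  have hL : ∀ ω, lexFrac W a x (0 + m) ω = ∑ s, (B s).indicator (fun _ => 1 / ((m : ℝ) + 1)) ω := by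
    intro ω
    have := sum_indicator_lt (lexCount_le a x (W (0 + m) ω))
    rw [lexFrac, ← this, Finset.sum_div]
    refine Finset.sum_congr rfl fun s _ => ?_
    by_cases hs : (s : ℕ) < lexCount a x (W (0 + m) ω)
    · rw [if_pos hs, Set.indicator_of_mem (show ω ∈ B s from hs)]; push_cast; rw [zero_add]
    · rw [if_neg hs, Set.indicator_of_notMem (show ω ∉ B s from hs)]; simp
  have hR : P.real (lexEvent W η a x 0 m 0 ∩ C) = ∑ s, P.real (B s ∩ C) / (m + 1) := by
    rw [measureReal_congr ((h.lexEvent_ae_eq a x 0 m 0).inter (ae_eq_refl C)),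
      measureReal_eq_sum_fiber (hS.measurable_track 0 m 0)]
    refine Finset.sum_congr rfl fun s _ => ?_
    rw [← hS.prob_track_zero m s _ ((hB s).inter hC)]
    congr 1
    ext ω
    simp only [Set.mem_inter_iff, Set.mem_preimage, Set.mem_singleton_iff, Set.mem_ofPred_eq, B]
    constructor
    · rintro ⟨rfl, h2, h3⟩; exact ⟨rfl, h2, h3⟩
    · rintro ⟨rfl, h2, h3⟩; exact ⟨rfl, h2, h3⟩
  rw [integral_indicator_one (h.measurableSet_lexEvent a x 0 m 0),
    measureReal_restrict_apply (h.measurableSet_lexEvent a x 0 m 0), hR]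
  simp only [hL]
  rw [integral_finsetSum _ fun s _ => (integrable_const _).indicator (hle _ (hB s))]
  refine Finset.sum_congr rfl fun s _ => ?_
  rw [integral_indicator_const _ (hle _ (hB s)), measureReal_restrict_apply (hle _ (hB s)),
    smul_eq_mul]
  ring

/-- The proportions of letters in an ergodic GEWP concentrate. -/
theorem IsErgodicGEWP.exists_tendsto_lexFrac (h : IsErgodicGEWP W η P) (a : A) (x : ℝ) :
    ∃ c, Tendsto (fun N => ∫ ω, |lexFrac W a x N ω - c| ∂P) atTop (𝓝 0) := by
  set D := limLexEvent W η a x 0 0 with hD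
  have hDm := h.1.measurableSet_limLexEvent a x 0 0
  let f : Ω → ℝ := D.indicator 1
  have hf : MemLp f 2 P := (memLp_const (1 : ℝ)).indicator hDm
  have hfi : Integrable f P := (integrable_const (1 : ℝ)).indicator hDm
  have h1 := tendsto_integral_abs_condExp_sub h.1.backwardFiltration_le antitone_backwardFiltration
    h.measure_eq_zero_or_one hf
  have h2 : Tendsto (fun m => P.real (symmDiff (lexEvent W η a x 0 m 0) D)) atTop (𝓝 0) := by
    have := (ENNReal.tendsto_toReal ENNReal.zero_ne_top).comp (h.1.tendsto_lexEvent a x 0 0)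
    rwa [ENNReal.toReal_zero] at this
  refine ⟨∫ ω, f ω ∂P, squeeze_zero (fun N => integral_nonneg fun _ => abs_nonneg _) (fun N => ?_)
    (by simpa using h2.add h1)⟩
  have hEm := h.1.measurableSet_lexEvent a x 0 N 0
  let g : Ω → ℝ := (lexEvent W η a x 0 N 0).indicator 1
  have hgi : Integrable g P := (integrable_const (1 : ℝ)).indicator hEm
  have hV := h.1.lexFrac_ae_eq_condExp a x N
  rw [zero_add] at hV
  have hi1 : Integrable (fun ω => |(P[g - f | backwardFiltration W η N]) ω|) P :=
    integrable_condExp.abs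
  have hi2 : Integrable (fun ω => |(P[f | backwardFiltration W η N]) ω - ∫ ω, f ω ∂P|) P :=
    (integrable_condExp.sub (integrable_const _)).abs
  -- The conditioned event varies with `N`; conditional expectation contracts L¹, so it may be
  -- replaced by its limit `D` before applying Lévy's theorem.
  have e1 : ∫ ω, |lexFrac W a x N ω - ∫ ω, f ω ∂P| ∂P ≤
      ∫ ω, (|(P[g - f | backwardFiltration W η N]) ω| +
        |(P[f | backwardFiltration W η N]) ω - ∫ ω, f ω ∂P|) ∂P := by
    refine integral_mono_ae ?_ (hi1.add hi2) ?_
    · exact (((integrable_congr hV).2 integrable_condExp).sub (integrable_const _)).abs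
    · filter_upwards [hV, condExp_sub hgi hfi (backwardFiltration W η N)] with ω h3 h4
      simp only [h3, h4, Pi.sub_apply]
      exact abs_sub_le _ _ _
  refine e1.trans ?_
  rw [integral_add hi1 hi2]
  refine add_le_add_left ((integral_abs_condExp_le _).trans_eq ?_) _
  rw [← integral_indicator_one (hEm.symmDiff hDm)]
  exact integral_congr_ae (ae_of_all _ fun ω => abs_indicator_one_sub _ _ ω)

theorem card_filter_not_iff_le {k : ℕ} (y z : ℝ) :
    open scoped Classical in
    ((Finset.univ.filter fun s : Fin k => ¬(((s : ℕ) : ℝ) < y ↔ ((s : ℕ) : ℝ) < z)).card : ℝ) ≤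
      |y - z| + 1 := by
  classical
  have := card_le_of_abs_sub_le (Finset.univ.filter fun s : Fin k =>
    ¬(((s : ℕ) : ℝ) < y ↔ ((s : ℕ) : ℝ) < z)) ((y + z) / 2) (|y - z| / 2) (by positivity) (by
      intro s hs
      have hs := (Finset.mem_filter.1 hs).2
      rcases abs_cases (y - z) with ⟨h1, h2⟩ | ⟨h1, h2⟩ <;> rw [h1, abs_le] <;>
        by_cases h3 : ((s : ℕ) : ℝ) < y <;> by_cases h4 : ((s : ℕ) : ℝ) < z <;>
        simp_all <;> constructor <;> linarith)
  linarith

/-- The future of a process of innovations. -/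
abbrev futureField (ξ : ∀ n : ℕ, Ω → Fin (n + 1)) (n : ℕ) : MeasurableSpace Ω :=
  ⨆ k ≥ n + 1, MeasurableSpace.comap (ξ k) inferInstance

theorem measurable_track_futureField (ξ : ∀ n : ℕ, Ω → Fin (n + 1)) (n m : ℕ) (j : Fin (n + 1)) :
    Measurable[futureField ξ n] fun ω => track (fun k => ξ k ω) n m j := by
  induction m with
  | zero => exact measurable_const
  | succ m ih =>
    have h1 : Measurable[futureField ξ n] (ξ (n + m + 1)) :=
      Measurable.of_comap_le (le_iSup₂_of_le (n + m + 1) (by omega) le_rfl)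
    exact measurable_comp₂ (fun (e : Fin (n + m + 1 + 1)) s => e.succAbove s) h1 ih

/-- The lexicographic events are determined by the sorted erasers. -/
theorem IsErgodicGEWP.measurableSet_limLexEvent (h : IsErgodicGEWP W η P) (a : A) (x : ℝ) (n : ℕ)
    (j : Fin (n + 1)) : MeasurableSet[completion P (futureField (sortedEraser W η) n)]
      (limLexEvent W η a x n j) := by
  classical
  obtain ⟨c, hc⟩ := h.exists_tendsto_lexFrac a x
  have hS := h.1.uniformInnovations_sortedEraser
  let t : ∀ m, Ω → Fin (n + m + 1) := fun m ω => track (fun k => sortedEraser W η k ω) n m j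
  let B : ℕ → Set Ω := fun m => {ω | ((t m ω : ℕ) : ℝ) < c * (n + m + 1)}
  refine measurableSet_completion_of_tendsto _ B (fun m => ?_) ?_
  · exact measurable_track_futureField _ n m j
      (MeasurableSet.of_discrete (s := {s : Fin (n + m + 1) | ((s : ℕ) : ℝ) < c * (n + m + 1)}))
  -- The two events differ only if the tracked position `s` separates the thresholds `c * (n + m +
  -- 1)` and `lexCount`. That `s` does so is an event of F_{n+m}, so `prob_track_le` applies, and
  -- the expected number of such `s` is at most the mean gap between the thresholds plus one.
  have key : ∀ m, P.real (symmDiff (B m) (lexEvent W η a x n m j)) ≤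
      (n + 1) * (∫ ω, |lexFrac W a x (n + m) ω - c| ∂P + 1 / (n + m + 1)) := by
    intro m
    let E : Fin (n + m + 1) → Set Ω := fun s =>
      {ω | ¬(((s : ℕ) : ℝ) < c * (n + m + 1) ↔
        ((s : ℕ) : ℝ) < (lexCount a x (W (n + m) ω) : ℝ))}
    have hWm := measurable_word_backwardFiltration (W := W) (η := η) (le_refl (n + m))
    have hE : ∀ s, MeasurableSet[backwardFiltration W η (n + m)] (E s) := fun s =>
      hWm (MeasurableSet.of_discrete (s := {w | ¬(((s : ℕ) : ℝ) < c * (n + m + 1) ↔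
        ((s : ℕ) : ℝ) < (lexCount a x w : ℝ))}))
    have hEm : ∀ s, MeasurableSet (E s) := fun s => h.1.backwardFiltration_le _ _ (hE s)
    have hpos : (0 : ℝ) < n + m + 1 := by positivity
    have hsum : ∑ s, P.real (E s) ≤
        (n + m + 1) * ∫ ω, |lexFrac W a x (n + m) ω - c| ∂P + 1 := by
      have hi : Integrable (fun ω => |lexFrac W a x (n + m) ω - c|) P :=
        ((h.1.integrable_lexFrac a x (n + m)).sub (integrable_const c)).abs
      have hEi : ∀ s, Integrable ((E s).indicator (1 : Ω → ℝ)) P := fun s =>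
        (integrable_const (1 : ℝ)).indicator (hEm s)
      have e1 : ∑ s, P.real (E s) = ∫ ω, ∑ s, (E s).indicator (1 : Ω → ℝ) ω ∂P := by
        rw [integral_finsetSum _ fun s _ => hEi s]
        exact Finset.sum_congr rfl fun s _ => (integral_indicator_one (hEm s)).symm
      have e2 : (n + m + 1) * ∫ ω, |lexFrac W a x (n + m) ω - c| ∂P + 1 =
          ∫ ω, ((n + m + 1) * |lexFrac W a x (n + m) ω - c| + 1) ∂P := by
        rw [integral_add (hi.const_mul _) (integrable_const _), integral_const_mul]
        simp
      rw [e1, e2]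
      refine integral_mono (integrable_finsetSum _ fun s _ => hEi s)
        ((hi.const_mul _).add (integrable_const _)) fun ω => ?_
      have e3 := card_filter_not_iff_le (k := n + m + 1) (c * (n + m + 1))
        (lexCount a x (W (n + m) ω))
      have e4 : |c * ((n : ℝ) + m + 1) - lexCount a x (W (n + m) ω)| =
          (n + m + 1) * |lexFrac W a x (n + m) ω - c| := by
        rw [abs_sub_comm, ← abs_of_pos hpos, ← abs_mul, abs_of_pos hpos, lexFrac]
        congr 1
        push_cast
        field_simp
      rw [e4, Finset.card_filter] at e3
      refine le_trans (le_of_eq ?_) e3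
      push_cast
      refine Finset.sum_congr rfl fun s _ => ?_
      simp only [Set.indicator_apply, Pi.one_apply]
      rfl
    have hae : (symmDiff (B m) (lexEvent W η a x n m j) : Set Ω) ≤ᵐ[P]
        (⋃ s ∈ Finset.univ, {ω | t m ω = s} ∩ E s : Set Ω) := by
      filter_upwards [h.1.lexEvent_ae_eq a x n m j] with ω hω hd
      have hω' : ω ∈ lexEvent W η a x n m j ↔ (t m ω : ℕ) < lexCount a x (W (n + m) ω) :=
        iff_of_eq hω
      have hd' : ω ∈ symmDiff (B m) (lexEvent W η a x n m j) := hd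
      change ω ∈ (⋃ s ∈ Finset.univ, {ω | t m ω = s} ∩ E s : Set Ω)
      simp only [Set.mem_iUnion]
      refine ⟨t m ω, Finset.mem_univ _, rfl, ?_⟩
      change ¬(((t m ω : ℕ) : ℝ) < c * (n + m + 1) ↔
        ((t m ω : ℕ) : ℝ) < (lexCount a x (W (n + m) ω) : ℝ))
      rw [Nat.cast_lt, ← hω']
      rw [Set.mem_symmDiff] at hd'
      change ¬(ω ∈ B m ↔ _)
      tauto
    calc P.real (symmDiff (B m) (lexEvent W η a x n m j))
        ≤ P.real (⋃ s ∈ Finset.univ, {ω | t m ω = s} ∩ E s) :=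
          ENNReal.toReal_mono (measure_ne_top _ _) (measure_mono_ae hae)
      _ ≤ ∑ s, P.real ({ω | t m ω = s} ∩ E s) := measureReal_biUnion_finset_le _ _
      _ ≤ ∑ s, ((n + 1) / (n + m + 1) : ℝ) * P.real (E s) :=
          Finset.sum_le_sum fun s _ => hS.prob_track_le n m j s _ (hE s)
      _ = ((n + 1) / (n + m + 1) : ℝ) * ∑ s, P.real (E s) := by rw [Finset.mul_sum]
      _ ≤ ((n + 1) / (n + m + 1) : ℝ) *
          ((n + m + 1) * ∫ ω, |lexFrac W a x (n + m) ω - c| ∂P + 1) :=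
          mul_le_mul_of_nonneg_left hsum (by positivity)
      _ = _ := by field_simp
  have hlim : Tendsto (fun m : ℕ => (n + 1 : ℝ) *
      (∫ ω, |lexFrac W a x (n + m) ω - c| ∂P + 1 / (n + m + 1))) atTop (𝓝 0) := by
    have h1 : Tendsto (fun m => n + m) atTop atTop := tendsto_add_atTop_nat n |>.congr fun m =>
      add_comm _ _
    have h2 := (hc.add tendsto_one_div_add_atTop_nhds_zero_nat).comp h1
    have h3 := h2.const_mul (n + 1 : ℝ)
    simpa [Function.comp_def] using h3
  have h1 : Tendsto (fun m => P (symmDiff (B m) (lexEvent W η a x n m j))) atTop (𝓝 0) := by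
    rw [← ENNReal.tendsto_toReal_iff (fun _ => measure_ne_top _ _) ENNReal.zero_ne_top]
    exact squeeze_zero (fun _ => measureReal_nonneg) key hlim
  have h2 := h1.add (h.1.tendsto_lexEvent a x n j)
  rw [add_zero] at h2
  exact tendsto_of_tendsto_of_tendsto_of_le_of_le tendsto_const_nhds h2 (fun _ => zero_le)
    fun m => measure_symmDiff_le _ _ _

end Concentration

/-! ### Recovering the words from the sorted erasers. -/

section Main

theorem measurableSet_sort_eq {Ω : Type*} {G : MeasurableSpace Ω} {n : ℕ} {U : Fin n → Ω → ℝ}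
    (hU : ∀ j, Measurable[G] (U j)) (τ : Equiv.Perm (Fin n)) :
    MeasurableSet[G] {ω | Tuple.sort (fun j => U j ω) = τ} := by
  have : {ω | Tuple.sort (fun j => U j ω) = τ} =
      (⋂ i, ⋂ j, {ω | i ≤ j → U (τ i) ω ≤ U (τ j) ω}) ∩
        ⋂ i, ⋂ j, {ω | i < j → U (τ i) ω = U (τ j) ω → τ i < τ j} := by
    ext ω
    rw [Set.mem_ofPred_eq, eq_comm, Tuple.eq_sort_iff]
    simp only [Set.mem_inter_iff, Set.mem_iInter, Set.mem_ofPred_eq]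
    exact Iff.rfl
  rw [this]
  refine MeasurableSet.inter ?_ ?_ <;>
    refine MeasurableSet.iInter fun i => MeasurableSet.iInter fun j => ?_
  · exact (MeasurableSet.const _).imp (measurableSet_le (hU _) (hU _))
  · exact (MeasurableSet.const _).imp ((measurableSet_eq_fun (hU _) (hU _)).imp (.const _))

theorem measurable_comp_sort {Ω A : Type*} {G : MeasurableSpace Ω} [MeasurableSpace A] [Finite A]
    [MeasurableSingletonClass A] {n : ℕ} {U : Fin n → Ω → ℝ} (hU : ∀ j, Measurable[G] (U j))
    {X : Fin n → Ω → A} (hX : ∀ j, Measurable[G] (X j)) :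
    Measurable[G] fun ω i => X (Tuple.sort (fun j => U j ω) i) ω := by
  refine measurable_to_countable' fun w => ?_
  have : (fun ω i => X (Tuple.sort (fun j => U j ω) i) ω) ⁻¹' {w} =
      ⋃ τ : Equiv.Perm (Fin n), {ω | Tuple.sort (fun j => U j ω) = τ} ∩
        ⋂ i, X (τ i) ⁻¹' {w i} := by
    ext ω
    simp [funext_iff]
  rw [this]
  exact MeasurableSet.iUnion fun τ => (measurableSet_sort_eq hU τ).inter
    (MeasurableSet.iInter fun i => hX _ (measurableSet_singleton _))

variable {Ω : Type*} {m₀ : MeasurableSpace Ω} {P : Measure Ω} [IsProbabilityMeasure P]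
  {A : Type*} [Fintype A] [LinearOrder A] [MeasurableSpace A] [MeasurableSingletonClass A]
  {W : ∀ n : ℕ, Ω → Fin (n + 1) → A} {η : ∀ n : ℕ, Ω → Fin (n + 1)}

/-- The letters of the sorted word are determined by the sorted erasers. -/
theorem IsErgodicGEWP.measurableSet_letter_eq (h : IsErgodicGEWP W η P) (n : ℕ)
    (j : Fin (n + 1)) (a : A) : MeasurableSet[completion P (futureField (sortedEraser W η) n)]
      {ω | W n ω (Tuple.sort (W n ω) j) = a} := by
  have hle : ∀ a, MeasurableSet[completion P (futureField (sortedEraser W η) n)]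
      {ω | W n ω (Tuple.sort (W n ω) j) ≤ a} := by
    intro a
    -- Letting the position bound grow removes it, since limiting positions are finite.
    have : {ω | W n ω (Tuple.sort (W n ω) j) ≤ a} = ⋃ k : ℕ, limLexEvent W η a k n j := by
      ext ω
      simp only [limLexEvent, Set.mem_iUnion, Set.mem_ofPred_eq]
      constructor
      · intro hω
        obtain ⟨k, hk⟩ := exists_nat_ge (limPos η n (Tuple.sort (W n ω) j) ω)
        exact ⟨k, hω.lt_or_eq.imp_right fun h' => ⟨h', hk⟩⟩
      · rintro ⟨k, hk | hk⟩
        · exact hk.le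
        · exact hk.1.le
    rw [this]
    exact MeasurableSet.iUnion fun k => h.measurableSet_limLexEvent a k n j
  have : {ω | W n ω (Tuple.sort (W n ω) j) = a} = {ω | W n ω (Tuple.sort (W n ω) j) ≤ a} \
      ⋃ b : A, ⋃ _ : b < a, {ω | W n ω (Tuple.sort (W n ω) j) ≤ b} := by
    ext ω
    simp only [Set.mem_ofPred_eq, Set.mem_sdiff, Set.mem_iUnion, not_exists, not_le]
    constructor
    · rintro rfl
      exact ⟨le_rfl, fun b hb => hb⟩
    · rintro ⟨h1, h2⟩
      exact h1.eq_or_lt.resolve_right fun h3 => lt_irrefl _ (h2 _ h3)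
  rw [this]
  exact (hle a).diff (MeasurableSet.iUnion fun b => MeasurableSet.iUnion fun _ => hle b)

/-- The words are determined by the sorted erasers. -/
theorem IsErgodicGEWP.measurable_word_completion (h : IsErgodicGEWP W η P) (n : ℕ) :
    Measurable[completion P (futureField (sortedEraser W η) n)] (W n) := by
  let X : Fin (n + 1) → Ω → A := fun j ω => W n ω (Tuple.sort (W n ω) j)
  let U : Fin (n + 1) → Ω → ℝ := fun j ω => limPos η n (Tuple.sort (W n ω) j) ω
  have hX : ∀ j, Measurable[completion P (futureField (sortedEraser W η) n)] (X j) := fun j =>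
    @measurable_to_countable' _ _ _ _ (_) _ fun a => h.measurableSet_letter_eq n j a
  have hU : ∀ j, Measurable[completion P (futureField (sortedEraser W η) n)] (U j) := by
    intro j
    refine measurable_of_Iic fun x => ?_
    have : U j ⁻¹' Set.Iic x = ⋃ a : A, {ω | W n ω (Tuple.sort (W n ω) j) = a} ∩
        limLexEvent W η a x n j := by
      ext ω
      simp [U, limLexEvent]
    rw [this]
    exact MeasurableSet.iUnion fun a =>
      (h.measurableSet_letter_eq n j a).inter (h.measurableSet_limLexEvent a x n j)
  refine measurable_completion_congr (measurable_comp_sort hU hX) ?_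
  filter_upwards [h.1.uniformInnovations_eraser.strictMono_limPos n] with ω hω
  -- Limiting positions increase strictly with the position in the word, so sorting the letters by
  -- them undoes the alphabetical sorting.
  have hsort : Tuple.sort (fun j => U j ω) = (Tuple.sort (W n ω))⁻¹ := by
    refine (Tuple.eq_sort_iff.2 ?_).symm
    have h1 : ∀ i, U ((Tuple.sort (W n ω))⁻¹ i) ω = limPos η n i ω := fun i => by simp [U]
    refine ⟨fun i j hij => ?_, fun i j hij hU => ?_⟩
    · simp only [Function.comp_apply, h1]
      exact hω.monotone hij
    · simp only [h1] at hU
      exact absurd hU (hω hij).ne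
  funext i
  simp [X, hsort]

theorem IsErgodicGEWP.generates_sortedEraser (h : IsErgodicGEWP W η P) :
    Generates (sortedEraser W η) (backwardFiltration W η) P := by
  intro n
  have hmono : ∀ k ≥ n, futureField (sortedEraser W η) k ≤ futureField (sortedEraser W η) n :=
    fun k hk => iSup₂_le fun l hl => le_iSup₂_of_le l (le_trans (Nat.succ_le_succ hk) hl) le_rfl
  have hW : ∀ k ≥ n, Measurable[completion P (futureField (sortedEraser W η) n)] (W k) :=
    fun k hk => (h.measurable_word_completion k).mono (completion_mono (hmono k hk)) le_rfl
  refine ⟨aeSubfield_iff.2 (iSup₂_le fun k hk => sup_le (hW k hk).comap_le ?_),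
    aeSubfield_iff.2 (le_trans (iSup₂_le fun k hk => ?_) le_eventuallyMeasurableSpace)⟩
  · refine (measurable_eraser_of_sortedEraser (hW (k + 1) (le_trans hk (Nat.le_succ k)))
      (Measurable.mono (Measurable.of_comap_le ?_) le_eventuallyMeasurableSpace le_rfl)).comap_le
    exact le_iSup₂_of_le (k + 1) (Nat.succ_le_succ hk) le_rfl
  · obtain ⟨l, rfl⟩ : ∃ l, k = l + 1 := ⟨k - 1, by omega⟩
    exact (h.1.uniformInnovations_sortedEraser.adapted l).comap_le.trans
      (antitone_backwardFiltration (Nat.le_of_succ_le_succ hk))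

end Main

end ErasedWord

theorem mainTheorem4 {A : Type*} [Fintype A] [LinearOrder A] [MeasurableSpace A]
    [MeasurableSingletonClass A]
    {Ω : Type*} [MeasurableSpace Ω] (P : Measure Ω) [IsProbabilityMeasure P]
    (W : ∀ n : ℕ, Ω → Fin (n + 1) → A) (η : ∀ n : ℕ, Ω → Fin (n + 1))
    (h : ErasedWord.IsErgodicGEWP W η P) :
    ErasedWord.IsLocalInnovations (ErasedWord.backwardFiltration W η)
        (ErasedWord.sortedEraser W η) P ∧
      ErasedWord.Generates (ErasedWord.sortedEraser W η) (ErasedWord.backwardFiltration W η) P ∧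
      ErasedWord.IsProductType (ErasedWord.backwardFiltration W η) P := by
  have hS := h.1.uniformInnovations_sortedEraser
  exact ⟨h.1.isLocalInnovations_sortedEraser, h.generates_sortedEraser,
    fun n => Fin (n + 1), fun _ => inferInstance, fun _ => inferInstance,
    ErasedWord.sortedEraser W η, hS.measurable, hS.iIndepFun, h.generates_sortedEraser⟩
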